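/- Let $M$ be a closed (compact, without boundary) smooth manifold of dimension $n$. Let $\mathcal S=\Gamma(S^2T^*M)$ be the Fréchet space (with the $C^\infty$ topology) of smooth symmetric $(0,2)$-tensor fields on $M$, and let $\mathcal M\subset\mathcal S$ be the open subset of smooth Riemannian metrics on $M$, so that $T_g\mathcal M\cong\mathcal S$ for every $g\in\mathcal M$. The $L^2$ metric on $\mathcal M$ is the weak Riemannian metric $$(h,k)_g=\int_M \operatorname{tr}_g(hk)\,\mu_g,\qquad \operatorname{tr}_g(hk)=\operatorname{tr}(g^{-1}hg^{-1}k),\qquad g\in\mathcal M,\ h,k\in\mathcal S,$$ where $\mu_g$ is the Riemannian volume of $g$ (locally $\sqrt{\det (g_{ij})}\,dx^1\cdots dx^n$), and $\|h\|_g=\sqrt{(h,h)_g}$. For $g_0,g_1\in\mathcal M$ let $$d(g_0,g_1)=\inf_{\alpha}\int_a^b\|\alpha'(t)\|_{\alpha(t)}\,dt,$$ where the infimum is taken over all piecewise $C^1$ paths $\alpha:[a,b]\to\mathcal M$ with $\alpha(a)=g_0$ and $\alpha(b)=g_1$. **Theorem.** $(\mathcal M,d)$ is a metric space: $d$ is a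 (finite, nonnegative, symmetric) function on $\mathcal M\times\mathcal M$ that satisfies the triangle inequality, $d(g,g)=0$ for all $g\in\mathcal M$, and $d(g_0,g_1)>0$ whenever $g_0\neq g_1$. -/

import Mathlib

open Set Filter Topology MeasureTheory Bundle
open scoped Manifold ContDiff

noncomputable section

namespace ManifoldOfMetrics

/-- The model space `ℝⁿ` of an `n`-dimensional manifold. -/
abbrev Model (n : ℕ) : Type := EuclideanSpace ℝ (Fin n)

section Definitions

variable (n : ℕ) (M : Type*) [TopologicalSpace M] [ChartedSpace (Model n) M]

instance instAddCommGroupCotangent (x : M) : AddCommGroup (TangentSpace (𝓡 n) x →L[ℝ] ℝ) :=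
  ContinuousLinearMap.addCommGroup

instance instContinuousAddCotangent (x : M) : ContinuousAdd (TangentSpace (𝓡 n) x →L[ℝ] ℝ) :=
  inferInstance

instance instFiniteDimensionalTangentSpace (x : M) :
    FiniteDimensional ℝ (TangentSpace (𝓡 n) x) :=
  inferInstanceAs (FiniteDimensional ℝ (Model n))

variable [IsManifold (𝓡 n) ∞ M]

/-- The vector space `𝓢 = Γ(S²T*M)` of smooth symmetric `(0,2)`-tensor fields on `M`. -/
def SymTensorField :
    Submodule ℝ (∀ x : M, TangentSpace (𝓡 n) x →L[ℝ] TangentSpace (𝓡 n) x →L[ℝ] ℝ) where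
  carrier := {h | (∀ (x : M) (v w : TangentSpace (𝓡 n) x), h x v w = h x w v) ∧
    ContMDiff (𝓡 n) ((𝓡 n).prod 𝓘(ℝ, Model n →L[ℝ] Model n →L[ℝ] ℝ)) ∞
      (fun x ↦ TotalSpace.mk' (Model n →L[ℝ] Model n →L[ℝ] ℝ) x (h x))}
  add_mem' := by
    rintro h k ⟨hh, hh'⟩ ⟨hk, hk'⟩
    refine ⟨fun x v w ↦ by simp [hh x v w, hk x v w], ?_⟩
    exact ContMDiff.add_section hh' hk'
  zero_mem' := by
    refine ⟨fun x v w ↦ by simp, ?_⟩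
    exact contMDiff_zeroSection _ _
  smul_mem' := by
    rintro c h ⟨hh, hh'⟩
    refine ⟨fun x v w ↦ by simp [hh x v w], ?_⟩
    exact ContMDiff.const_smul_section hh'

instance instAddCommGroupSymTensorField : AddCommGroup (SymTensorField n M) :=
  Submodule.addCommGroup _

instance instModuleSymTensorField : Module ℝ (SymTensorField n M) :=
  Submodule.module _

/-- The set `𝓜` of smooth Riemannian metrics on `M`. -/
abbrev Metrics : Type _ :=
  ContMDiffRiemannianMetric (𝓡 n) ∞ (Model n) (fun x : M ↦ TangentSpace (𝓡 n) x)

variable {n M}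

/-- The inclusion of `𝓜` in the vector space `𝓢`. -/
def toSym (g : Metrics n M) : SymTensorField n M :=
  ⟨g.inner, g.symm, g.contMDiff⟩

/-- The coordinate vector field `∂ᵢ` of the chart at `x₀`, at a point `x` of its domain. -/
def coordVec (x₀ : M) (i : Fin n) (x : M) : TangentSpace (𝓡 n) x :=
  (trivializationAt (Model n) (fun x : M ↦ TangentSpace (𝓡 n) x) x₀).symmL ℝ x
    (EuclideanSpace.single i (1 : ℝ))

/-- The coefficient `h_{ij}` of a tensor field in the chart at `x₀`, as a function on the image of
the chart (its values elsewhere play no role). -/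
def coeff (x₀ : M) (i j : Fin n) (h : SymTensorField n M) (y : Model n) : ℝ :=
  h.1 ((chartAt (Model n) x₀).symm y)
    (coordVec x₀ i ((chartAt (Model n) x₀).symm y))
    (coordVec x₀ j ((chartAt (Model n) x₀).symm y))

/-- The `C^∞` (Fréchet) topology of `𝓢`: uniform convergence, on the compact subsets of the charts
of `M`, of the coefficients together with all their derivatives. -/
instance instTopologicalSpaceSymTensorField : TopologicalSpace (SymTensorField n M) :=
  ⨅ (x₀ : M) (i : Fin n) (j : Fin n) (k : ℕ),
    TopologicalSpace.induced
      (fun h ↦ UniformOnFun.ofFun {K | IsCompact K ∧ K ⊆ (chartAt (Model n) x₀).target}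
        (iteratedFDeriv ℝ k (coeff x₀ i j h)))
      inferInstance

/-- A tensor field at `x`, as a bilinear form on the tangent space `T_x M`. -/
def formAt (h : SymTensorField n M) (x : M) : LinearMap.BilinForm ℝ (TangentSpace (𝓡 n) x) :=
  LinearMap.mk₂ ℝ (fun v w ↦ h.1 x v w) (by simp) (by simp) (by simp) (by simp)

theorem formAt_nondegenerate (g : Metrics n M) (x : M) : (formAt (toSym g) x).Nondegenerate := by
  refine ⟨fun v hv ↦ ?_, fun v hv ↦ ?_⟩ <;>
  · by_contra hne
    exact (g.pos x v hne).ne' (hv v)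

/-- The endomorphism `H = g⁻¹ h` of `T_x M` obtained by raising an index of `h` with `g`, that is,
`g(H v, w) = h(v, w)`. -/
def raise (g : Metrics n M) (h : SymTensorField n M) (x : M) :
    TangentSpace (𝓡 n) x →ₗ[ℝ] TangentSpace (𝓡 n) x :=
  (formAt h x).symmCompOfNondegenerate (formAt (toSym g) x) (formAt_nondegenerate g x)

/-- The function `tr_g(hk) = tr(g⁻¹ h g⁻¹ k)` on `M`. -/
def traceProd (g : Metrics n M) (h k : SymTensorField n M) (x : M) : ℝ :=
  LinearMap.trace ℝ (TangentSpace (𝓡 n) x) (raise g h x ∘ₗ raise g k x)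

/-- `√(det g_{ij})` in the chart at `x₀`, as a function on the image of the chart. -/
def sqrtDet (x₀ : M) (g : Metrics n M) (y : Model n) : ℝ :=
  √(Matrix.of fun i j ↦ coeff x₀ i j (toSym g) y).det

variable [CompactSpace M] [T2Space M]

variable (n M) in
/-- A smooth partition of unity subordinate to the charts of `M`. -/
def chartPartition : SmoothPartitionOfUnity M (𝓡 n) M :=
  (SmoothPartitionOfUnity.exists_isSubordinate_chartAt_source (𝓡 n) M).choose

variable [MeasurableSpace M] [BorelSpace M]

/-- The Riemannian volume measure `μ_g`: the measures `√(det g_{ij}) dx¹ ⋯ dxⁿ` of the charts,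
put together with a partition of unity (the result does not depend on the partition). -/
def volumeMeasure (g : Metrics n M) : Measure M :=
  Measure.sum fun x₀ : M ↦
    ((((volume : Measure (Model n)).restrict (chartAt (Model n) x₀).target).withDensity
      fun y ↦ ENNReal.ofReal (sqrtDet x₀ g y)).map (chartAt (Model n) x₀).symm).withDensity
        fun x ↦ ENNReal.ofReal (chartPartition n M x₀ x)

/-- The `L²` Riemannian metric `(h, k)_g = ∫_M tr_g(hk) μ_g` on `T_g 𝓜 = 𝓢`. -/
def l2Inner (g : Metrics n M) (h k : SymTensorField n M) : ℝ :=
  ∫ x, traceProd g h k x ∂(volumeMeasure g)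

/-- The norm `‖h‖_g = √((h, h)_g)`. -/
def l2Norm (g : Metrics n M) (h : SymTensorField n M) : ℝ := √(l2Inner g h h)

end Definitions

section Distance

variable {n : ℕ} {M : Type*} [TopologicalSpace M] [ChartedSpace (Model n) M]
  [IsManifold (𝓡 n) ∞ M]

/-- On `[a, b]`, the path `α` in `𝓜` is `C¹` as a path in the Fréchet space `𝓢`, with (one-sided
at the end points) derivative `v`. -/
def IsC1On (α : ℝ → Metrics n M) (v : ℝ → SymTensorField n M) (a b : ℝ) : Prop :=
  ContinuousOn v (Icc a b) ∧
    ∀ s ∈ Icc a b, Tendsto (slope (fun t ↦ toSym (α t)) s) (𝓝[Icc a b \ {s}] s) (𝓝 (v s))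

/-- A piecewise `C¹` path `[a, b] → 𝓜` from `g₀` to `g₁`, with its velocity. There is a subdivision
`a = t₀ ≤ t₁ ≤ ⋯ ≤ t_N = b` such that the path is `C¹` on every `[t_i, t_{i+1}]`; at the points
`t_i` the value of `velocity` is arbitrary. -/
structure MetricPath (g₀ g₁ : Metrics n M) where
  a : ℝ
  b : ℝ
  le : a ≤ b
  toFun : ℝ → Metrics n M
  velocity : ℝ → SymTensorField n M
  source : toFun a = g₀
  target : toFun b = g₁
  piecewise : ∃ (N : ℕ) (t : ℕ → ℝ), Monotone t ∧ t 0 = a ∧ t N = b ∧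
    ∀ i < N, ∃ v : ℝ → SymTensorField n M,
      IsC1On toFun v (t i) (t (i + 1)) ∧ ∀ s ∈ Ioo (t i) (t (i + 1)), velocity s = v s

variable [CompactSpace M] [T2Space M] [MeasurableSpace M] [BorelSpace M]

/-- The length `∫_a^b ‖α'(t)‖_{α(t)} dt` of a path. -/
def MetricPath.length {g₀ g₁ : Metrics n M} (p : MetricPath g₀ g₁) : ℝ :=
  ∫ t in p.a..p.b, l2Norm (p.toFun t) (p.velocity t)

/-- The distance function `d` of the `L²` metric: the infimum of the lengths of the piecewise `C¹`
paths from `g₀` to `g₁`. -/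
def l2Dist (g₀ g₁ : Metrics n M) : ℝ := ⨅ p : MetricPath g₀ g₁, p.length

end Distance

end ManifoldOfMetrics

end

/-!
The axioms of a distance other than positivity are formal: paths can be reversed, translated in time
and concatenated, and any two metrics are joined by a segment. They do use that the speed of a path
is integrable. For this, `l2Inner_self_eq_sum` writes `(h, h)_g` as a finite sum of integrals over
compact subsets of charts, and `IsC1On.continuousOn_energy` shows that the integrands are jointly
continuous in time and position along a `C¹` path.

For positivity, it is enough to find a functional on `𝓜` that takes different values at `g₀` and
`g₁` and is Lipschitz for the length of paths. On positive definite matrices `A`, consider the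
functions `F(A) = (det A)^{1/4} (c + a) / (1 + a)`, where `a = wᵀAw` and `0 ≤ c ≤ 1` (`separator`).

* Their derivative in the direction `B` is at most `(√n + 1) (tr(A⁻¹BA⁻¹B) √det A)^{1/2}`
  (`exists_hasDerivAt_separator`): with `T = tr(A⁻¹BA⁻¹B)`, one has `|tr(A⁻¹B)| ≤ √n √T` and
  `|wᵀBw| ≤ a √T`, because `A` and `B` can be normalised to the identity and a symmetric matrix of
  Frobenius norm `√T`.
* They separate points (`exists_separator_ne`): `c = 1` gives the determinant, and then `c = 0`
  gives the quadratic form.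

If `g₀ ≠ g₁`, choose a point where they differ, a function `ρ` of the partition of unity that is
positive there, and a small compact ball `K` in the chart of `ρ`, on which `ρ` is bounded below and
some `F` is larger for one metric than for the other. Then `g ↦ ∫_K F(g_{ij})` separates `g₀` from
`g₁`. Integrating the pointwise bound for the derivative over `K`, exchanging the integrals over
time and space, and applying the Cauchy–Schwarz inequality on `K` bounds its increment along a path
by a multiple of the length (`MetricPath.chartFunctional_sub_le`). Since only one term of the sum
that defines `μ_g` is used, no change of coordinates is needed.
-/

noncomputable section

namespace ManifoldOfMetrics

/-! ### Positive definite matrices -/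

section Matrix

open Matrix

variable {ι : Type*} [Fintype ι] [DecidableEq ι]

/-- The squared norm of `B` at `A` for the Riemannian metric `tr(A⁻¹BA⁻¹B)√det A` on the positive
definite matrices: the coordinate expression of the integrand of `(h, h)_g`. -/
def energy (A B : Matrix ι ι ℝ) : ℝ := (A⁻¹ * B * (A⁻¹ * B)).trace * √A.det

theorem exists_isUnit_transpose_mul_self {A : Matrix ι ι ℝ} (hA : A.PosDef) :
    ∃ P : Matrix ι ι ℝ, IsUnit P ∧ A = Pᵀ * P := by
  open scoped MatrixOrder in
  obtain ⟨P, hP⟩ := CStarAlgebra.nonneg_iff_eq_star_mul_self.mp hA.posSemidef.nonneg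
  have hP' : A = Pᵀ * P := by rw [hP, star_eq_conjTranspose, conjTranspose_eq_transpose_of_trivial]
  refine ⟨P, ?_, hP'⟩
  have h := hA.det_pos
  rw [hP', det_mul, det_transpose] at h
  rw [isUnit_iff_isUnit_det]
  exact (mul_self_pos.mp h).isUnit

/-- Simultaneous normalisation: in a basis that is orthonormal for `A`, the form `B` becomes a
symmetric matrix `C`. -/
theorem exists_normal_form {A B : Matrix ι ι ℝ} (hA : A.PosDef) (hB : B.IsSymm) :
    ∃ C P : Matrix ι ι ℝ, C.IsSymm ∧ A = Pᵀ * P ∧ B = Pᵀ * C * P ∧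
      (A⁻¹ * B).trace = C.trace ∧ (A⁻¹ * B * (A⁻¹ * B)).trace = ∑ i, ∑ j, C i j ^ 2 := by
  obtain ⟨P, hP, rfl⟩ := exists_isUnit_transpose_mul_self hA
  have hd : IsUnit P.det := (isUnit_iff_isUnit_det P).mp hP
  have hdt : IsUnit Pᵀ.det := by rwa [det_transpose]
  have h1 : P⁻¹ * P = 1 := nonsing_inv_mul _ hd
  have h2 : P * P⁻¹ = 1 := mul_nonsing_inv _ hd
  have h3 : Pᵀ * (Pᵀ)⁻¹ = 1 := mul_nonsing_inv _ hdt
  have hC : ((Pᵀ)⁻¹ * B * P⁻¹).IsSymm := by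
    rw [IsSymm, transpose_mul, transpose_mul, hB.eq, transpose_nonsing_inv, transpose_nonsing_inv,
      transpose_transpose, Matrix.mul_assoc]
  have hAB : (Pᵀ * P)⁻¹ * B = P⁻¹ * ((Pᵀ)⁻¹ * B * P⁻¹) * P := by
    rw [Matrix.mul_inv_rev]; simp only [Matrix.mul_assoc, h1, Matrix.mul_one]
  refine ⟨(Pᵀ)⁻¹ * B * P⁻¹, P, hC, rfl, ?_, ?_, ?_⟩
  · simp only [← Matrix.mul_assoc, h3, Matrix.one_mul]
    rw [Matrix.mul_assoc, h1, Matrix.mul_one]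
  · rw [hAB, trace_mul_comm, ← Matrix.mul_assoc, h2, Matrix.one_mul]
  · rw [hAB]
    set C := (Pᵀ)⁻¹ * B * P⁻¹
    have : P⁻¹ * C * P * (P⁻¹ * C * P) = P⁻¹ * (C * C * P) := by
      simp only [Matrix.mul_assoc]
      rw [← Matrix.mul_assoc P P⁻¹, h2, Matrix.one_mul]
    rw [this, trace_mul_comm, Matrix.mul_assoc, h2, Matrix.mul_one, trace]
    refine Finset.sum_congr rfl fun i _ ↦ ?_
    rw [diag_apply, mul_apply]
    refine Finset.sum_congr rfl fun j _ ↦ ?_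
    rw [hC.apply i j, sq]

theorem energy_nonneg {A B : Matrix ι ι ℝ} (hA : A.PosDef) (hB : B.IsSymm) : 0 ≤ energy A B := by
  obtain ⟨C, P, -, -, -, -, h⟩ := exists_normal_form hA hB
  rw [energy, h]
  positivity

theorem abs_trace_inv_mul_le {A B : Matrix ι ι ℝ} (hA : A.PosDef) (hB : B.IsSymm) :
    |(A⁻¹ * B).trace| ≤ √(Fintype.card ι) * √(A⁻¹ * B * (A⁻¹ * B)).trace := by
  obtain ⟨C, P, -, -, -, h1, h2⟩ := exists_normal_form hA hB
  rw [h1, h2, ← Real.sqrt_mul (by positivity), ← Real.sqrt_sq_eq_abs]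
  refine Real.sqrt_le_sqrt ?_
  calc C.trace ^ 2 ≤ Fintype.card ι * ∑ i, C i i ^ 2 := sq_sum_le_card_mul_sum_sq
    _ ≤ _ := by
      gcongr with i
      exact Finset.single_le_sum (f := fun j ↦ C i j ^ 2) (fun j _ ↦ sq_nonneg _)
        (Finset.mem_univ i)

theorem abs_dotProduct_mulVec_le {A B : Matrix ι ι ℝ} (hA : A.PosDef) (hB : B.IsSymm)
    (w : ι → ℝ) : |w ⬝ᵥ B *ᵥ w| ≤ (w ⬝ᵥ A *ᵥ w) * √(A⁻¹ * B * (A⁻¹ * B)).trace := by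
  obtain ⟨C, P, -, hA', hB', -, h2⟩ := exists_normal_form hA hB
  have key (Q : Matrix ι ι ℝ) : w ⬝ᵥ (Pᵀ * Q * P) *ᵥ w = (P *ᵥ w) ⬝ᵥ Q *ᵥ (P *ᵥ w) := by
    rw [Matrix.mul_assoc, ← mulVec_mulVec, ← mulVec_mulVec, dotProduct_mulVec, vecMul_transpose]
  have hA'' : w ⬝ᵥ A *ᵥ w = (P *ᵥ w) ⬝ᵥ (P *ᵥ w) := by
    rw [hA', ← Matrix.mul_one Pᵀ, key, one_mulVec]
  rw [h2, hA'', hB', key]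
  set u := P *ᵥ w
  have hu : 0 ≤ u ⬝ᵥ u := by
    simp only [dotProduct, ← sq]; positivity
  rw [← Real.sqrt_sq hu, ← Real.sqrt_mul (by positivity), ← Real.sqrt_sq_eq_abs]
  refine Real.sqrt_le_sqrt ?_
  have e1 : u ⬝ᵥ C *ᵥ u = ∑ p : ι × ι, u p.1 * u p.2 * C p.1 p.2 := by
    rw [Fintype.sum_prod_type]
    simp only [dotProduct, mulVec, Finset.mul_sum]
    refine Finset.sum_congr rfl fun i _ ↦ Finset.sum_congr rfl fun j _ ↦ by ring
  have e2 : (u ⬝ᵥ u) ^ 2 = ∑ p : ι × ι, (u p.1 * u p.2) ^ 2 := by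
    rw [Fintype.sum_prod_type, sq, dotProduct, Finset.sum_mul_sum]
    refine Finset.sum_congr rfl fun i _ ↦ Finset.sum_congr rfl fun j _ ↦ by ring
  rw [e1, e2, ← Fintype.sum_prod_type' (f := fun i j ↦ C i j ^ 2)]
  exact Finset.sum_mul_sq_le_sq_mul_sq _ _ _

/-- Jacobi's formula for the derivative of a determinant. -/
theorem hasDerivAt_det {A : ℝ → Matrix ι ι ℝ} {B : Matrix ι ι ℝ} {s : ℝ}
    (h : ∀ i j, HasDerivAt (fun t ↦ A t i j) (B i j) s) :
    HasDerivAt (fun t ↦ (A t).det) ((A s).adjugate * B).trace s := by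
  have h1 : HasDerivAt (fun t ↦ (A t).det)
      (∑ σ : Equiv.Perm ι, (σ.sign : ℝ) * ∑ i, (∏ j ∈ Finset.univ.erase i, A s (σ j) j) *
        B (σ i) i) s := by
    simp only [det_apply']
    refine HasDerivAt.fun_sum fun σ _ ↦ HasDerivAt.const_mul _ ?_
    simpa only [smul_eq_mul] using
      HasDerivAt.fun_finsetProd (u := Finset.univ) fun i _ ↦ h (σ i) i
  convert h1 using 1
  simp only [Finset.mul_sum]
  rw [Finset.sum_comm, trace]
  refine Finset.sum_congr rfl fun i _ ↦ ?_
  have : ((A s).adjugate * B).diag i = ((A s).updateCol i (fun k ↦ B k i)).det := by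
    rw [← cramer_apply, cramer_eq_adjugate_mulVec]
    rfl
  rw [this, det_apply']
  refine Finset.sum_congr rfl fun σ _ ↦ ?_
  rw [← Finset.prod_erase_mul _ _ (Finset.mem_univ i), updateCol_self]
  congr 2
  refine Finset.prod_congr rfl fun j hj ↦ ?_
  rw [updateCol_ne (Finset.ne_of_mem_erase hj)]

/-- The functions `(det A)^{1/4} (c + a) / (1 + a)` with `a = wᵀAw`, for `0 ≤ c ≤ 1`. They are
Lipschitz for the metric `energy`, and those with `c = 0` and `c = 1` separate the positive
definite matrices. -/
def separator (c : ℝ) (w : ι → ℝ) (A : Matrix ι ι ℝ) : ℝ :=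
  A.det ^ (1 / 4 : ℝ) * ((c + w ⬝ᵥ A *ᵥ w) / (1 + w ⬝ᵥ A *ᵥ w))

/-- `separator c w` has a derivative which is bounded by a multiple of `√energy`. The weight
`(det A)^{1/4}` is forced by the factor `√det A` of `energy`. -/
theorem exists_hasDerivAt_separator {c : ℝ} (h0 : 0 ≤ c) (h1 : c ≤ 1) (w : ι → ℝ)
    {A : ℝ → Matrix ι ι ℝ} {B : Matrix ι ι ℝ} {s : ℝ}
    (hA : (A s).PosDef) (hB : B.IsSymm) (h : ∀ i j, HasDerivAt (fun t ↦ A t i j) (B i j) s) :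
    ∃ d, HasDerivAt (fun t ↦ separator c w (A t)) d s ∧
      d ≤ (√(Fintype.card ι) + 1) * √(energy (A s) B) := by
  have hD : 0 < (A s).det := hA.det_pos
  have ha : 0 ≤ w ⬝ᵥ A s *ᵥ w := by
    simpa using hA.posSemidef.dotProduct_mulVec_nonneg w
  have hdet := (hasDerivAt_det h).rpow_const (p := 1 / 4) (Or.inl hD.ne')
  have hq : HasDerivAt (fun t ↦ w ⬝ᵥ A t *ᵥ w) (w ⬝ᵥ B *ᵥ w) s := by
    simp only [dotProduct, mulVec]
    exact HasDerivAt.fun_sum fun i _ ↦ (HasDerivAt.fun_sum fun j _ ↦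
      (h i j).mul_const (w j)).const_mul (w i)
  have hG := (hq.const_add c).div (hq.const_add 1) (by positivity)
  refine ⟨_, hdet.mul hG, ?_⟩
  have hadj : ((A s).adjugate * B).trace = (A s).det * ((A s)⁻¹ * B).trace := by
    rw [Matrix.inv_def, smul_mul, trace_smul, Ring.inverse_eq_inv', smul_eq_mul,
      mul_inv_cancel_left₀ hD.ne']
  have hpow : (A s).det * (A s).det ^ (1 / 4 - 1 : ℝ) = (A s).det ^ (1 / 4 : ℝ) := by
    rw [Real.rpow_sub_one hD.ne']; field_simp
  have hsq : √(√(A s).det) = (A s).det ^ (1 / 4 : ℝ) := by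
    rw [Real.sqrt_eq_rpow, Real.sqrt_eq_rpow, ← Real.rpow_mul hD.le]; norm_num
  have ht := abs_trace_inv_mul_le hA hB
  have hb := abs_dotProduct_mulVec_le hA hB w
  rw [energy, Real.sqrt_mul', hsq, hadj]
  swap
  · positivity
  have hD4 : 0 < (A s).det ^ (1 / 4 : ℝ) := by positivity
  set T := √((A s)⁻¹ * B * ((A s)⁻¹ * B)).trace
  set a := w ⬝ᵥ A s *ᵥ w
  set b := w ⬝ᵥ B *ᵥ w
  set τ := ((A s)⁻¹ * B).trace
  set N := √(Fintype.card ι : ℝ)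
  have hT : 0 ≤ T := Real.sqrt_nonneg _
  have hN : 0 ≤ N := Real.sqrt_nonneg _
  have hGle : (c + a) / (1 + a) ≤ 1 := by rw [div_le_one (by positivity)]; linarith
  have hG0 : 0 ≤ (c + a) / (1 + a) := by positivity
  have hb2 : (b * (1 + a) - (c + a) * b) / (1 + a) ^ 2 ≤ T := by
    rw [div_le_iff₀ (by positivity)]
    have : b * (1 + a) - (c + a) * b = (1 - c) * b := by ring
    rw [this]
    calc (1 - c) * b ≤ (1 - c) * |b| :=
          mul_le_mul_of_nonneg_left (le_abs_self b) (by linarith)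
      _ ≤ 1 * |b| := by gcongr; linarith
      _ ≤ a * T := by simpa using hb
      _ ≤ T * (1 + a) ^ 2 := by nlinarith [mul_nonneg hT ha, mul_nonneg hT (sq_nonneg a)]
  have hτ : 1 / 4 * τ * ((c + a) / (1 + a)) ≤ N * T := by
    calc 1 / 4 * τ * ((c + a) / (1 + a)) ≤ 1 / 4 * |τ| * ((c + a) / (1 + a)) := by
          gcongr; exact le_abs_self τ
      _ ≤ 1 * |τ| * 1 := by gcongr; norm_num
      _ ≤ N * T := by simpa using ht
  calc _ = (A s).det ^ (1 / 4 : ℝ) * (1 / 4 * τ * ((c + a) / (1 + a)) +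
        (b * (1 + a) - (c + a) * b) / (1 + a) ^ 2) := by
        rw [← hpow]; ring
    _ ≤ (A s).det ^ (1 / 4 : ℝ) * (N * T + T) := by gcongr
    _ = _ := by ring

theorem eq_of_forall_dotProduct_mulVec_eq {A B : Matrix ι ι ℝ} (hA : A.IsSymm) (hB : B.IsSymm)
    (h : ∀ w, w ⬝ᵥ A *ᵥ w = w ⬝ᵥ B *ᵥ w) : A = B := by
  ext i j
  have e (i j : ι) := h (Pi.single i 1 + Pi.single j 1)
  have h1 := h (Pi.single i 1)
  have h2 := h (Pi.single j 1)
  have h3 := e i j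
  simp [mulVec_add, add_dotProduct, dotProduct_add] at h1 h2 h3
  linarith [hA.apply i j, hB.apply i j]

/-- The function with `c = 1` determines `det A`, and then those with `c = 0` determine the
quadratic form of `A`. -/
theorem exists_separator_ne {A B : Matrix ι ι ℝ} (hA : A.PosDef) (hB : B.PosDef) (hne : A ≠ B) :
    ∃ (c : ℝ) (w : ι → ℝ), 0 ≤ c ∧ c ≤ 1 ∧ separator c w A ≠ separator c w B := by
  by_contra! H
  have hpos {Q : Matrix ι ι ℝ} (hQ : Q.PosDef) (w : ι → ℝ) : 0 ≤ w ⬝ᵥ Q *ᵥ w := by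
    simpa using hQ.posSemidef.dotProduct_mulVec_nonneg w
  have hdet : A.det ^ (1 / 4 : ℝ) = B.det ^ (1 / 4 : ℝ) := by
    simpa [separator] using H 1 0 zero_le_one le_rfl
  refine hne (eq_of_forall_dotProduct_mulVec_eq ?_ ?_ fun w ↦ ?_)
  · simpa [IsSymm, IsHermitian] using hA.1
  · simpa [IsSymm, IsHermitian] using hB.1
  have h := H 0 w le_rfl zero_le_one
  rw [separator, separator, hdet] at h
  have hB4 : B.det ^ (1 / 4 : ℝ) ≠ 0 := (Real.rpow_pos_of_pos hB.det_pos _).ne'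
  have h := mul_left_cancel₀ hB4 h
  have := hpos hA w
  have := hpos hB w
  rw [zero_add, zero_add, div_eq_div_iff (by positivity) (by positivity)] at h
  linarith

theorem _root_.ContinuousOn.energy {X : Type*} [TopologicalSpace X] {S : Set X}
    {A B : X → Matrix ι ι ℝ} (hA : ContinuousOn A S) (hB : ContinuousOn B S)
    (h : ∀ x ∈ S, (A x).PosDef) : ContinuousOn (fun x ↦ energy (A x) (B x)) S := by
  have h1 : ContinuousOn (fun x ↦ (A x).det) S := continuous_id.matrix_det.comp_continuousOn hA
  have h2 : ContinuousOn (fun x ↦ (A x)⁻¹) S := by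
    simp only [Matrix.inv_def, Ring.inverse_eq_inv']
    exact (h1.inv₀ fun x hx ↦ (h x hx).det_pos.ne').smul
      (continuous_id.matrix_adjugate.comp_continuousOn hA)
  have h3 : ContinuousOn (fun x ↦ (A x)⁻¹ * B x) S := h2.mul hB
  exact (continuous_id.matrix_trace.comp_continuousOn (h3.mul h3)).mul h1.sqrt

theorem continuousOn_separator (c : ℝ) (w : ι → ℝ) :
    ContinuousOn (separator c w) {A : Matrix ι ι ℝ | A.PosDef} := by
  have h1 : Continuous fun A : Matrix ι ι ℝ ↦ A.det := continuous_id.matrix_det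
  have h2 : Continuous fun A : Matrix ι ι ℝ ↦ w ⬝ᵥ A *ᵥ w := by fun_prop
  refine (h1.continuousOn.rpow_const fun A hA ↦ Or.inl ?_).mul
    ((h2.const_add c).continuousOn.div (h2.const_add 1).continuousOn fun A hA ↦ ?_)
  · exact (show A.PosDef from hA).det_pos.ne'
  · have : 0 ≤ w ⬝ᵥ A *ᵥ w := by
      simpa using (show A.PosDef from hA).posSemidef.dotProduct_mulVec_nonneg w
    positivity

theorem _root_.ContinuousOn.separator {X : Type*} [TopologicalSpace X] {S : Set X}
    {A : X → Matrix ι ι ℝ} (hA : ContinuousOn A S) (h : ∀ x ∈ S, (A x).PosDef) (c : ℝ)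
    (w : ι → ℝ) : ContinuousOn (fun x ↦ separator c w (A x)) S :=
  (continuousOn_separator c w).comp hA h

end Matrix

/-! ### Tensor fields in a chart -/

section Chart

open Matrix

variable {n : ℕ} {M : Type*} [TopologicalSpace M] [ChartedSpace (Model n) M]
  [IsManifold (𝓡 n) ∞ M]

/-- The matrix `(h_{ij})` of a tensor field in the chart at `x₀`. -/
def gram (x₀ : M) (h : SymTensorField n M) (y : Model n) : Matrix (Fin n) (Fin n) ℝ :=
  Matrix.of fun i j ↦ coeff x₀ i j h y

theorem gram_isSymm (x₀ : M) (h : SymTensorField n M) (y : Model n) : (gram x₀ h y).IsSymm := by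
  ext i j
  exact h.2.1 _ _ _

/-- The coordinate vector fields form a basis of `T_x M` at the points `x` of the chart. -/
def coordBasis {x₀ x : M} (hx : x ∈ (chartAt (Model n) x₀).source) :
    Module.Basis (Fin n) ℝ (TangentSpace (𝓡 n) x) :=
  (trivializationAt (Model n) (fun x : M ↦ TangentSpace (𝓡 n) x) x₀).basisAt
    (EuclideanSpace.basisFun (Fin n) ℝ).toBasis hx

theorem coordBasis_apply {x₀ x : M} (hx : x ∈ (chartAt (Model n) x₀).source) (i : Fin n) :
    coordBasis hx i = coordVec x₀ i x := by
  simp only [coordBasis, coordVec, Trivialization.basisAt, Module.Basis.map_apply,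
    OrthonormalBasis.coe_toBasis, EuclideanSpace.basisFun_apply]
  exact (Trivialization.symmL_apply (R := ℝ) _ hx _).symm

theorem toMatrix_formAt {x₀ : M} {y : Model n} (hy : y ∈ (chartAt (Model n) x₀).target)
    (h : SymTensorField n M) :
    LinearMap.BilinForm.toMatrix (coordBasis ((chartAt (Model n) x₀).map_target hy))
      (formAt h ((chartAt (Model n) x₀).symm y)) = gram x₀ h y := by
  ext i j
  rw [LinearMap.BilinForm.toMatrix_apply, coordBasis_apply, coordBasis_apply]
  rfl

theorem gram_posDef {x₀ : M} {y : Model n} (hy : y ∈ (chartAt (Model n) x₀).target)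
    (g : Metrics n M) : (gram x₀ (toSym g) y).PosDef := by
  set b := coordBasis ((chartAt (Model n) x₀).map_target hy)
  refine .of_dotProduct_mulVec_pos ?_ fun w hw ↦ ?_
  · have := gram_isSymm x₀ (toSym g) y
    simpa [IsSymm, IsHermitian] using this
  · have h : star w ⬝ᵥ gram x₀ (toSym g) y *ᵥ w =
        formAt (toSym g) ((chartAt (Model n) x₀).symm y) (b.equivFun.symm w)
          (b.equivFun.symm w) := by
      have hr : ⇑(b.repr (b.equivFun.symm w)) = w := by
        rw [← b.equivFun_apply, LinearEquiv.apply_symm_apply]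
      rw [← toMatrix_formAt hy, LinearMap.BilinForm.apply_eq_dotProduct_toMatrix_mulVec b, hr,
        star_trivial]
    rw [h]
    refine g.pos _ _ fun h0 ↦ hw ?_
    exact (LinearEquiv.map_eq_zero_iff _).mp h0

theorem traceProd_eq {x₀ : M} {y : Model n} (hy : y ∈ (chartAt (Model n) x₀).target)
    (g : Metrics n M) (h : SymTensorField n M) :
    traceProd g h h ((chartAt (Model n) x₀).symm y) =
      ((gram x₀ (toSym g) y)⁻¹ * gram x₀ h y *
        ((gram x₀ (toSym g) y)⁻¹ * gram x₀ h y)).trace := by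
  set x := (chartAt (Model n) x₀).symm y
  set b := coordBasis ((chartAt (Model n) x₀).map_target hy)
  have hR : LinearMap.toMatrix b b (raise g h x) = (gram x₀ (toSym g) y)⁻¹ * gram x₀ h y := by
    have e : (LinearMap.toMatrix b b (raise g h x))ᵀ * gram x₀ (toSym g) y = gram x₀ h y := by
      rw [← toMatrix_formAt hy, ← toMatrix_formAt hy h,
        ← LinearMap.BilinForm.toMatrix_compLeft b]
      congr 1
      refine LinearMap.ext₂ fun v w ↦ ?_
      exact LinearMap.BilinForm.symmCompOfNondegenerate_left_apply
        (formAt h x) (formAt_nondegenerate g x) w v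
    have e' := congrArg transpose e
    rw [transpose_mul, transpose_transpose, (gram_isSymm _ _ _).eq, (gram_isSymm _ _ _).eq] at e'
    rw [← e', nonsing_inv_mul_cancel_left]
    exact (gram_posDef hy g).det_pos.ne'.isUnit
  rw [traceProd, LinearMap.trace_eq_matrix_trace ℝ b, LinearMap.toMatrix_comp b b b, hR]

/-- The integrand of `(h, h)_g` in the coordinates of a chart. -/
theorem traceProd_mul_sqrtDet {x₀ : M} {y : Model n} (hy : y ∈ (chartAt (Model n) x₀).target)
    (g : Metrics n M) (h : SymTensorField n M) :
    sqrtDet x₀ g y * traceProd g h h ((chartAt (Model n) x₀).symm y) =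
      energy (gram x₀ (toSym g) y) (gram x₀ h y) := by
  rw [traceProd_eq hy, energy, mul_comm]
  rfl

theorem exists_gram_ne {g₀ g₁ : Metrics n M} (hne : g₀ ≠ g₁) :
    ∃ x : M, ∀ x₀ : M, x ∈ (chartAt (Model n) x₀).source →
      gram x₀ (toSym g₀) (chartAt (Model n) x₀ x) ≠
        gram x₀ (toSym g₁) (chartAt (Model n) x₀ x) := by
  by_contra! H
  refine hne ?_
  have : g₀.inner = g₁.inner := by
    funext x
    obtain ⟨x₀, hx, h⟩ := H x
    have hy := (chartAt (Model n) x₀).map_source hx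
    rw [← toMatrix_formAt hy, ← toMatrix_formAt hy] at h
    have h' := (LinearMap.BilinForm.toMatrix _).injective h
    rw [(chartAt (Model n) x₀).left_inv hx] at h'
    ext v w
    exact LinearMap.congr_fun₂ h' v w
  cases g₀; cases g₁; cases this; rfl

theorem continuousOn_coeff_source (x₀ : M) (i j : Fin n) (h : SymTensorField n M) :
    ContinuousOn (fun x ↦ h.1 x (coordVec x₀ i x) (coordVec x₀ j x))
      (chartAt (Model n) x₀).source := by
  have hv (k : Fin n) : ContMDiffOn (𝓡 n) ((𝓡 n).prod 𝓘(ℝ, Model n)) 0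
      (fun x ↦ TotalSpace.mk' (Model n) x (coordVec x₀ k x))
      (chartAt (Model n) x₀).source := by
    have := (trivializationAt (Model n) (fun x : M ↦ TangentSpace (𝓡 n) x)
      x₀).contMDiffOn_localFrame_baseSet (I := 𝓡 n) 0
        (EuclideanSpace.basisFun (Fin n) ℝ).toBasis k
    refine this.congr fun x hx ↦ ?_
    rw [← coordBasis_apply hx, Trivialization.localFrame_apply_of_mem_baseSet _ _ hx]
    rfl
  have hh : ContMDiffOn (𝓡 n) ((𝓡 n).prod 𝓘(ℝ, Model n →L[ℝ] Model n →L[ℝ] ℝ)) 0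
      (fun x ↦ TotalSpace.mk' (Model n →L[ℝ] Model n →L[ℝ] ℝ) x (h.1 x))
      (chartAt (Model n) x₀).source :=
    (h.2.2.of_le (by simp)).contMDiffOn
  intro x hx
  have : ContMDiffWithinAt (𝓡 n) ((𝓡 n).prod 𝓘(ℝ)) 0
      (fun m ↦ TotalSpace.mk' ℝ (E := Bundle.Trivial M ℝ) m
        (h.1 m (coordVec x₀ i m) (coordVec x₀ j m))) (chartAt (Model n) x₀).source x :=
    ContMDiffWithinAt.clm_bundle_apply₂ (F₁ := Model n) (F₂ := Model n)
      (hh x hx) (hv i x hx) (hv j x hx)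
  simp only [contMDiffWithinAt_totalSpace] at this
  exact this.2.continuousWithinAt

theorem continuousOn_gram_source (x₀ : M) (h : SymTensorField n M) :
    ContinuousOn (fun x ↦ gram x₀ h (chartAt (Model n) x₀ x)) (chartAt (Model n) x₀).source := by
  refine continuousOn_pi.mpr fun i ↦ continuousOn_pi.mpr fun j ↦
    (continuousOn_coeff_source x₀ i j h).congr fun x hx ↦ ?_
  exact congrArg (fun z ↦ h.1 z (coordVec x₀ i z) (coordVec x₀ j z))
    ((chartAt (Model n) x₀).left_inv hx)

theorem continuousOn_coeff (x₀ : M) (i j : Fin n) (h : SymTensorField n M) :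
    ContinuousOn (coeff x₀ i j h) (chartAt (Model n) x₀).target :=
  (continuousOn_coeff_source x₀ i j h).comp (chartAt (Model n) x₀).continuousOn_symm
    (chartAt (Model n) x₀).mapsTo_symm

theorem continuousOn_gram (x₀ : M) (h : SymTensorField n M) :
    ContinuousOn (gram x₀ h) (chartAt (Model n) x₀).target :=
  continuousOn_pi.mpr fun i ↦ continuousOn_pi.mpr fun j ↦ continuousOn_coeff x₀ i j h

theorem continuousOn_energy_gram (x₀ : M) (g : Metrics n M) (h : SymTensorField n M) :
    ContinuousOn (fun y ↦ energy (gram x₀ (toSym g) y) (gram x₀ h y))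
      (chartAt (Model n) x₀).target :=
  (continuousOn_gram x₀ (toSym g)).energy (continuousOn_gram x₀ h) fun _ hy ↦ gram_posDef hy g

theorem continuous_traceProd (g : Metrics n M) (h : SymTensorField n M) :
    Continuous (traceProd g h h) := by
  refine continuous_iff_continuousAt.mpr fun x₀ ↦ ?_
  have hs := (chartAt (Model n) x₀).open_source.mem_nhds (mem_chart_source (Model n) x₀)
  refine ContinuousOn.continuousAt (s := (chartAt (Model n) x₀).source) ?_ hs
  have hg := continuousOn_gram_source x₀ (toSym g)
  have hdet (x) (hx : x ∈ (chartAt (Model n) x₀).source) :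
      0 < (gram x₀ (toSym g) (chartAt (Model n) x₀ x)).det :=
    (gram_posDef ((chartAt (Model n) x₀).map_source hx) g).det_pos
  have hd : ContinuousOn (fun x ↦ (gram x₀ (toSym g) (chartAt (Model n) x₀ x)).det)
      (chartAt (Model n) x₀).source :=
    (continuous_id.matrix_det).comp_continuousOn hg
  refine ((hg.energy (continuousOn_gram_source x₀ h) fun x hx ↦
    gram_posDef ((chartAt (Model n) x₀).map_source hx) g).div hd.sqrt fun x hx ↦
      (Real.sqrt_pos.mpr (hdet x hx)).ne').congr fun x hx ↦ ?_
  have e := traceProd_mul_sqrtDet ((chartAt (Model n) x₀).map_source hx) g h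
  rw [(chartAt (Model n) x₀).left_inv hx] at e
  rw [Pi.div_apply, ← e, sqrtDet]
  exact (mul_div_cancel_left₀ _ (Real.sqrt_pos.mpr (hdet x hx)).ne').symm

/-- Convergence in `𝓢` implies uniform convergence of the coefficients on compact sets. -/
theorem tendstoUniformlyOn_coeff {β : Type*} {l : Filter β} {u : β → SymTensorField n M}
    {h : SymTensorField n M} (hu : Tendsto u l (𝓝 h)) (x₀ : M) (i j : Fin n) {K : Set (Model n)}
    (hK : IsCompact K) (hK' : K ⊆ (chartAt (Model n) x₀).target) :
    TendstoUniformlyOn (fun b ↦ coeff x₀ i j (u b)) (coeff x₀ i j h) l K := by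
  have hc : Continuous fun h : SymTensorField n M ↦
      UniformOnFun.ofFun {K | IsCompact K ∧ K ⊆ (chartAt (Model n) x₀).target}
        (iteratedFDeriv ℝ 0 (coeff x₀ i j h)) :=
    continuous_iff_le_induced.mpr ((iInf_le _ x₀).trans <| (iInf_le _ i).trans <|
      (iInf_le _ j).trans (iInf_le _ 0))
  have := UniformOnFun.tendsto_iff_tendstoUniformlyOn.mp ((hc.tendsto h).comp hu) K ⟨hK, hK'⟩
  rw [Metric.tendstoUniformlyOn_iff] at this ⊢
  intro ε hε
  filter_upwards [this ε hε] with b hb y hy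
  have := hb y hy
  simp only [Function.comp, UniformOnFun.toFun_ofFun, dist_eq_norm] at this ⊢
  rwa [iteratedFDeriv_zero_eq_comp, iteratedFDeriv_zero_eq_comp, Function.comp, Function.comp,
    ← map_sub, LinearIsometryEquiv.norm_map] at this

theorem tendsto_coeff {β : Type*} {l : Filter β} {u : β → SymTensorField n M}
    {h : SymTensorField n M} (hu : Tendsto u l (𝓝 h)) (x₀ : M) (i j : Fin n) {y : Model n}
    (hy : y ∈ (chartAt (Model n) x₀).target) :
    Tendsto (fun b ↦ coeff x₀ i j (u b) y) l (𝓝 (coeff x₀ i j h y)) :=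
  (tendstoUniformlyOn_coeff hu x₀ i j isCompact_singleton (singleton_subset_iff.mpr hy)).tendsto_at
    rfl

instance instContinuousNegSymTensorField : ContinuousNeg (SymTensorField n M) where
  continuous_neg := by
    refine continuous_iInf_rng.mpr fun x₀ ↦ continuous_iInf_rng.mpr fun i ↦
      continuous_iInf_rng.mpr fun j ↦ continuous_iInf_rng.mpr fun k ↦ continuous_induced_rng.mpr ?_
    have hc : Continuous fun h : SymTensorField n M ↦
        UniformOnFun.ofFun {K | IsCompact K ∧ K ⊆ (chartAt (Model n) x₀).target}
          (iteratedFDeriv ℝ k (coeff x₀ i j h)) :=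
      continuous_iff_le_induced.mpr ((iInf_le _ x₀).trans <| (iInf_le _ i).trans <|
        (iInf_le _ j).trans (iInf_le _ k))
    refine hc.neg.congr fun h ↦ ?_
    have : coeff x₀ i j (-h) = -coeff x₀ i j h := rfl
    simp only [Function.comp, this]
    rw [iteratedFDeriv_neg]
    rfl

end Chart

/-! ### The `L²` metric in charts -/

section L2

variable {n : ℕ} {M : Type*} [TopologicalSpace M] [ChartedSpace (Model n) M]
  [IsManifold (𝓡 n) ∞ M] [CompactSpace M] [T2Space M]

variable (n) in
/-- The support of the function with index `x₀` of the partition of unity, in the chart at `x₀`. -/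
def chartSupport (x₀ : M) : Set (Model n) :=
  chartAt (Model n) x₀ '' tsupport (chartPartition n M x₀)

theorem tsupport_chartPartition_subset (x₀ : M) :
    tsupport (chartPartition n M x₀) ⊆ (chartAt (Model n) x₀).source :=
  (SmoothPartitionOfUnity.exists_isSubordinate_chartAt_source (𝓡 n) M).choose_spec x₀

theorem isCompact_chartSupport (x₀ : M) : IsCompact (chartSupport n x₀) :=
  (isClosed_tsupport _).isCompact.image_of_continuousOn
    ((chartAt (Model n) x₀).continuousOn.mono (tsupport_chartPartition_subset x₀))

theorem chartSupport_subset (x₀ : M) : chartSupport n x₀ ⊆ (chartAt (Model n) x₀).target := by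
  rintro _ ⟨x, hx, rfl⟩
  exact (chartAt (Model n) x₀).map_source (tsupport_chartPartition_subset x₀ hx)

theorem mem_chartSupport {x₀ : M} {y : Model n} (hy : y ∈ (chartAt (Model n) x₀).target)
    (h : chartPartition n M x₀ ((chartAt (Model n) x₀).symm y) ≠ 0) : y ∈ chartSupport n x₀ :=
  ⟨_, subset_tsupport _ h, (chartAt (Model n) x₀).right_inv hy⟩

variable (n M) in
/-- The indices of the functions of the partition of unity that do not vanish identically. -/
def chartIndices : Finset M :=
  (chartPartition n M).locallyFinite.finite_nonempty_of_compact.toFinset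

theorem chartPartition_eq_zero {x₀ : M} (h : x₀ ∉ chartIndices n M) (x : M) :
    chartPartition n M x₀ x = 0 := by
  by_contra hx
  exact h ((Finite.mem_toFinset _).mpr ⟨x, hx⟩)

/-- The integrand of `(h, h)_g` in the chart at `x₀`, cut off by the partition of unity. -/
def chartEnergy (x₀ : M) (g : Metrics n M) (h : SymTensorField n M) (y : Model n) : ℝ :=
  chartPartition n M x₀ ((chartAt (Model n) x₀).symm y) *
    energy (gram x₀ (toSym g) y) (gram x₀ h y)

theorem chartEnergy_nonneg {x₀ : M} (g : Metrics n M) (h : SymTensorField n M) {y : Model n}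
    (hy : y ∈ (chartAt (Model n) x₀).target) : 0 ≤ chartEnergy x₀ g h y :=
  mul_nonneg ((chartPartition n M).nonneg _ _)
    (energy_nonneg (gram_posDef hy g) (gram_isSymm _ _ _))

theorem continuousOn_chartPartition_symm (x₀ : M) :
    ContinuousOn (fun y ↦ chartPartition n M x₀ ((chartAt (Model n) x₀).symm y))
      (chartAt (Model n) x₀).target :=
  (chartPartition n M x₀).contMDiff.continuous.comp_continuousOn (chartAt (Model n) x₀).continuousOn_symm

theorem continuousOn_chartEnergy (x₀ : M) (g : Metrics n M) (h : SymTensorField n M) :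
    ContinuousOn (chartEnergy x₀ g h) (chartAt (Model n) x₀).target :=
  (continuousOn_chartPartition_symm x₀).mul (continuousOn_energy_gram x₀ g h)

theorem integrableOn_chartEnergy (x₀ : M) (g : Metrics n M) (h : SymTensorField n M) :
    IntegrableOn (chartEnergy x₀ g h) (chartSupport n x₀) :=
  ((continuousOn_chartEnergy x₀ g h).mono (chartSupport_subset x₀)).integrableOn_compact
    (isCompact_chartSupport x₀)

theorem setIntegral_chartEnergy_nonneg (x₀ : M) (g : Metrics n M) (h : SymTensorField n M) :
    0 ≤ ∫ y in chartSupport n x₀, chartEnergy x₀ g h y :=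
  setIntegral_nonneg (isCompact_chartSupport x₀).measurableSet fun _ hy ↦
    chartEnergy_nonneg g h (chartSupport_subset x₀ hy)

variable [MeasurableSpace M]

/-- The part of the Riemannian volume that is contributed by the chart at `x₀`. -/
def chartVolume (x₀ : M) (g : Metrics n M) : Measure M :=
  ((((volume : Measure (Model n)).restrict (chartAt (Model n) x₀).target).withDensity
    fun y ↦ ENNReal.ofReal (sqrtDet x₀ g y)).map (chartAt (Model n) x₀).symm).withDensity
      fun x ↦ ENNReal.ofReal (chartPartition n M x₀ x)

theorem volumeMeasure_eq_sum (g : Metrics n M) :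
    volumeMeasure g = ∑ x₀ ∈ chartIndices n M, chartVolume x₀ g := by
  ext s hs
  rw [volumeMeasure, Measure.sum_apply _ hs, Measure.finsetSum_apply]
  refine tsum_eq_sum fun x₀ hx₀ ↦ ?_
  simp [chartPartition_eq_zero hx₀]

variable [BorelSpace M]

theorem integrable_and_integral_chartVolume (x₀ : M) (g : Metrics n M) (h : SymTensorField n M) :
    Integrable (traceProd g h h) (chartVolume x₀ g) ∧
      ∫ x, traceProd g h h x ∂(chartVolume x₀ g) =
        ∫ y in chartSupport n x₀, chartEnergy x₀ g h y := by
  set e := chartAt (Model n) x₀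
  set ρ := chartPartition n M x₀
  have ht : MeasurableSet e.target := e.open_target.measurableSet
  set μ := (volume : Measure (Model n)).restrict e.target
  have hs : AEMeasurable (fun y ↦ ENNReal.ofReal (sqrtDet x₀ g y)) μ := by
    refine (ContinuousOn.aemeasurable ?_ ht).ennreal_ofReal
    exact ((continuous_id.matrix_det).comp_continuousOn (continuousOn_gram x₀ (toSym g))).sqrt
  have he : AEMeasurable e.symm (μ.withDensity fun y ↦ ENNReal.ofReal (sqrtDet x₀ g y)) :=
    (e.continuousOn_symm.aemeasurable ht).mono_ac (withDensity_absolutelyContinuous _ _)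
  have hρ : Measurable fun x ↦ ENNReal.ofReal (ρ x) := ρ.contMDiff.continuous.measurable.ennreal_ofReal
  have hf : Continuous fun x ↦ ρ x * traceProd g h h x :=
    ρ.contMDiff.continuous.mul (continuous_traceProd g h)
  have hρ0 (x : M) : (ENNReal.ofReal (ρ x)).toReal = ρ x :=
    ENNReal.toReal_ofReal ((chartPartition n M).nonneg _ _)
  have hs0 (y : Model n) : (ENNReal.ofReal (sqrtDet x₀ g y)).toReal = sqrtDet x₀ g y :=
    ENNReal.toReal_ofReal (Real.sqrt_nonneg _)
  have hE (y : Model n) (hy : y ∈ e.target) :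
      sqrtDet x₀ g y * (ρ (e.symm y) * traceProd g h h (e.symm y)) = chartEnergy x₀ g h y := by
    rw [chartEnergy, ← traceProd_mul_sqrtDet hy]; ring
  have h0 : ∀ y ∈ e.target \ chartSupport n x₀, chartEnergy x₀ g h y = 0 := by
    rintro y ⟨hy, hy'⟩
    have : ρ (e.symm y) = 0 := by
      by_contra hne
      exact hy' (mem_chartSupport hy hne)
    rw [chartEnergy, this, zero_mul]
  constructor
  · rw [chartVolume, integrable_withDensity_iff_integrable_smul' hρ (by simp)]
    simp only [hρ0, smul_eq_mul]
    rw [integrable_map_measure hf.aestronglyMeasurable he,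
      integrable_withDensity_iff_integrable_smul₀' hs (by simp)]
    simp only [hs0, smul_eq_mul, Function.comp]
    have : IntegrableOn (chartEnergy x₀ g h) e.target :=
      (integrableOn_chartEnergy x₀ g h).of_forall_sdiff_eq_zero ht h0
    exact this.congr_fun (fun y hy ↦ (hE y hy).symm) ht
  · rw [chartVolume, integral_withDensity_eq_integral_toReal_smul hρ (by simp)]
    simp only [hρ0, smul_eq_mul]
    rw [integral_map he hf.aestronglyMeasurable,
      integral_withDensity_eq_integral_toReal_smul₀ hs (by simp)]
    simp only [hs0, smul_eq_mul]
    rw [setIntegral_congr_fun ht hE,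
      setIntegral_eq_of_subset_of_forall_sdiff_eq_zero ht (chartSupport_subset x₀) h0]

/-- The `L²` metric as a finite sum of integrals over compact subsets of charts. -/
theorem l2Inner_self_eq_sum (g : Metrics n M) (h : SymTensorField n M) :
    l2Inner g h h = ∑ x₀ ∈ chartIndices n M, ∫ y in chartSupport n x₀, chartEnergy x₀ g h y := by
  rw [l2Inner, volumeMeasure_eq_sum, integral_finsetSum_measure fun x₀ _ ↦
    (integrable_and_integral_chartVolume x₀ g h).1]
  exact Finset.sum_congr rfl fun x₀ _ ↦ (integrable_and_integral_chartVolume x₀ g h).2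

/-- On a compact set where a function of the partition of unity is bounded below, the `L²` norm
dominates the norm in the chart. -/
theorem mul_setIntegral_energy_le {x₀ : M} {K : Set (Model n)} (hK : IsCompact K)
    (hK' : K ⊆ (chartAt (Model n) x₀).target) {ε : ℝ} (hε : 0 < ε)
    (hρ : ∀ y ∈ K, ε ≤ chartPartition n M x₀ ((chartAt (Model n) x₀).symm y))
    (g : Metrics n M) (h : SymTensorField n M) :
    ε * ∫ y in K, energy (gram x₀ (toSym g) y) (gram x₀ h y) ≤ l2Inner g h h := by
  have hKs : K ⊆ chartSupport n x₀ := fun y hy ↦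
    mem_chartSupport (hK' hy) (hε.trans_le (hρ y hy)).ne'
  have hE := ((continuousOn_energy_gram x₀ g h).mono hK').integrableOn_compact (μ := volume) hK
  calc ε * ∫ y in K, energy (gram x₀ (toSym g) y) (gram x₀ h y)
      = ∫ y in K, ε * energy (gram x₀ (toSym g) y) (gram x₀ h y) :=
        (integral_const_mul _ _).symm
    _ ≤ ∫ y in K, chartEnergy x₀ g h y := by
        refine setIntegral_mono_on (hE.const_mul ε)
          ((integrableOn_chartEnergy x₀ g h).mono_set hKs) hK.measurableSet fun y hy ↦ ?_
        exact mul_le_mul_of_nonneg_right (hρ y hy)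
          (energy_nonneg (gram_posDef (hK' hy) g) (gram_isSymm _ _ _))
    _ ≤ ∫ y in chartSupport n x₀, chartEnergy x₀ g h y :=
        setIntegral_mono_set (integrableOn_chartEnergy x₀ g h)
          (ae_restrict_of_forall_mem (isCompact_chartSupport x₀).measurableSet fun y hy ↦
            chartEnergy_nonneg g h (chartSupport_subset x₀ hy)) hKs.eventuallyLE
    _ ≤ l2Inner g h h := by
        rw [l2Inner_self_eq_sum]
        by_cases hx : x₀ ∈ chartIndices n M
        · exact Finset.single_le_sum
            (f := fun x₀ ↦ ∫ y in chartSupport n x₀, chartEnergy x₀ g h y)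
            (fun x _ ↦ setIntegral_chartEnergy_nonneg x g h) hx
        · have : chartEnergy x₀ g h = 0 := by
            funext y; simp [chartEnergy, chartPartition_eq_zero hx]
          rw [this]
          simpa using Finset.sum_nonneg fun x _ ↦ setIntegral_chartEnergy_nonneg x g h

theorem l2Norm_neg (g : Metrics n M) (h : SymTensorField n M) : l2Norm g (-h) = l2Norm g h := by
  rw [l2Norm, l2Norm, l2Inner_self_eq_sum, l2Inner_self_eq_sum]
  have (x₀ : M) (y : Model n) : chartEnergy x₀ g (-h) y = chartEnergy x₀ g h y := by
    have e : gram x₀ (-h) y = -gram x₀ h y := rfl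
    rw [chartEnergy, chartEnergy, energy, energy, e, Matrix.mul_neg, neg_mul_neg]
  simp only [this]

end L2

/-! ### `C¹` paths in charts -/

/-- A parametric integral over a compact set depends continuously on the parameter. -/
theorem continuousOn_setIntegral_of_isCompact {X Y : Type*} [TopologicalSpace X]
    [FirstCountableTopology X] [TopologicalSpace Y] [T2Space Y]
    [MeasurableSpace Y] [OpensMeasurableSpace Y]
    {μ : Measure Y} [IsFiniteMeasureOnCompacts μ] {f : X → Y → ℝ} {S : Set X} {K : Set Y}
    (hS : IsCompact S) (hK : IsCompact K)
    (hf : ContinuousOn (fun p : X × Y ↦ f p.1 p.2) (S ×ˢ K)) :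
    ContinuousOn (fun x ↦ ∫ y in K, f x y ∂μ) S := by
  obtain ⟨C, hC⟩ := (hS.prod hK).exists_bound_of_continuousOn hf
  have : IsFiniteMeasure (μ.restrict K) := isFiniteMeasure_restrict.mpr hK.measure_ne_top
  refine continuousOn_of_dominated (bound := fun _ ↦ C) (fun x hx ↦ ?_) (fun x hx ↦ ?_)
    (integrable_const C) ?_
  · refine ContinuousOn.aestronglyMeasurable_of_isCompact ?_ hK hK.measurableSet
    exact ContinuousOn.uncurry_left x hx hf
  · exact ae_restrict_of_forall_mem hK.measurableSet fun y hy ↦ hC (x, y) ⟨hx, hy⟩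
  · exact ae_restrict_of_forall_mem hK.measurableSet fun y hy ↦
      ContinuousOn.uncurry_right y hy hf

/-- The Cauchy–Schwarz inequality for `√f` and `1`. -/
theorem setIntegral_sqrt_le {X : Type*} [MeasurableSpace X] {μ : Measure X} {K : Set X}
    (hK : MeasurableSet K) (hμ : μ K ≠ ⊤) {f : X → ℝ} (hf : IntegrableOn f K μ)
    (hf' : IntegrableOn (fun x ↦ √(f x)) K μ) (h0 : ∀ x ∈ K, 0 ≤ f x) :
    ∫ x in K, √(f x) ∂μ ≤ √(μ.real K) * √(∫ x in K, f x ∂μ) := by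
  set V := μ.real K
  set I := ∫ x in K, √(f x) ∂μ
  set J := ∫ x in K, f x ∂μ
  have hV : 0 ≤ V := measureReal_nonneg
  have hI : 0 ≤ I := setIntegral_nonneg hK fun _ _ ↦ Real.sqrt_nonneg _
  have hc : IntegrableOn (fun _ : X ↦ (1 : ℝ)) K μ := integrableOn_const hμ
  -- the quadratic polynomial `∫ (√f - r)² = J - 2rI + r²V` is nonnegative
  have key (r : ℝ) : 0 ≤ J - 2 * r * I + r ^ 2 * V := by
    have e : ∫ x in K, (√(f x) - r) ^ 2 ∂μ = J - 2 * r * I + r ^ 2 * V := by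
      calc ∫ x in K, (√(f x) - r) ^ 2 ∂μ
          = ∫ x in K, (f x - 2 * r * √(f x) + r ^ 2 * 1) ∂μ := by
            refine setIntegral_congr_fun hK fun x hx ↦ ?_
            have := Real.sq_sqrt (h0 x hx)
            linear_combination this
        _ = _ := by
            have h1 : IntegrableOn (fun x ↦ f x - 2 * r * √(f x)) K μ :=
              hf.sub (hf'.const_mul (2 * r))
            rw [integral_add h1 (hc.const_mul (r ^ 2)),
              integral_sub hf (hf'.const_mul (2 * r)), integral_const_mul, integral_const_mul]
            simp [V, I, J]
    rw [← e]
    exact integral_nonneg fun _ ↦ sq_nonneg _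
  rw [← Real.sqrt_mul hV]
  refine Real.le_sqrt_of_sq_le ?_
  rcases hV.eq_or_lt with hV0 | hV0
  -- if `V = 0`, the polynomial is affine in `r`, hence `I = 0`
  · rw [← hV0] at key ⊢
    have h1 := key ((J + 1) / (2 * I))
    rcases hI.eq_or_lt with hI0 | hI0
    · rw [← hI0]; simp
    · field_simp at h1
      linarith
  -- otherwise its minimum is at `r = I / V`
  · have h1 := key (I / V)
    field_simp at h1
    nlinarith

section Path

variable {n : ℕ} {M : Type*} [TopologicalSpace M] [ChartedSpace (Model n) M]
  [IsManifold (𝓡 n) ∞ M]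

theorem integrableOn_separator (x₀ : M) {K : Set (Model n)} (hK : IsCompact K)
    (hK' : K ⊆ (chartAt (Model n) x₀).target) (c : ℝ) (w : Fin n → ℝ) (g : Metrics n M) :
    IntegrableOn (fun y ↦ separator c w (gram x₀ (toSym g) y)) K :=
  (((continuousOn_gram x₀ (toSym g)).mono hK').separator (fun _ hy ↦ gram_posDef (hK' hy) g)
    c w).integrableOn_compact hK

variable {α : ℝ → Metrics n M} {v : ℝ → SymTensorField n M} {a b : ℝ}

/-- A continuous path in `𝓢` has coefficients that are jointly continuous. -/
theorem continuousOn_coeff_uncurry (hv : ContinuousOn v (Icc a b)) (x₀ : M) (i j : Fin n)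
    {K : Set (Model n)} (hK : IsCompact K) (hK' : K ⊆ (chartAt (Model n) x₀).target) :
    ContinuousOn (fun p : ℝ × Model n ↦ coeff x₀ i j (v p.1) p.2) (Icc a b ×ˢ K) := by
  rintro ⟨s, y⟩ ⟨hs, hy⟩
  have h1 : Tendsto (fun p : ℝ × Model n ↦ p.1) (𝓝[Icc a b ×ˢ K] (s, y)) (𝓝[Icc a b] s) :=
    continuousWithinAt_fst.tendsto_nhdsWithin fun p hp ↦ hp.1
  have h2 : Tendsto (fun p : ℝ × Model n ↦ p.2) (𝓝[Icc a b ×ˢ K] (s, y)) (𝓝[K] y) :=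
    continuousWithinAt_snd.tendsto_nhdsWithin fun p hp ↦ hp.2
  have hU := tendstoUniformlyOn_coeff (hv s hs) x₀ i j hK hK'
  exact tendsto_comp_of_locally_uniform_limit_within
    ((continuousOn_coeff x₀ i j (v s)).mono hK' y hy) h2
    fun u hu ↦ ⟨K, self_mem_nhdsWithin, h1.eventually (hU u hu)⟩

theorem IsC1On.hasDerivWithinAt (h : IsC1On α v a b) {s : ℝ} (hs : s ∈ Icc a b) (x₀ : M)
    (i j : Fin n) {y : Model n} (hy : y ∈ (chartAt (Model n) x₀).target) :
    HasDerivWithinAt (fun t ↦ coeff x₀ i j (toSym (α t)) y) (coeff x₀ i j (v s) y) (Icc a b) s := by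
  rw [hasDerivWithinAt_iff_tendsto_slope]
  exact tendsto_coeff (h.2 s hs) x₀ i j hy

/-- A `C¹` path is jointly continuous in charts, being Lipschitz in time. -/
theorem IsC1On.continuousOn_coeff_uncurry (h : IsC1On α v a b) (x₀ : M) (i j : Fin n)
    {K : Set (Model n)} (hK : IsCompact K) (hK' : K ⊆ (chartAt (Model n) x₀).target) :
    ContinuousOn (fun p : ℝ × Model n ↦ coeff x₀ i j (toSym (α p.1)) p.2) (Icc a b ×ˢ K) := by
  obtain ⟨C, hC⟩ := (isCompact_Icc.prod hK).exists_bound_of_continuousOn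
    (ManifoldOfMetrics.continuousOn_coeff_uncurry h.1 x₀ i j hK hK')
  refine continuousOn_prod_of_continuousOn_lipschitzOnWith
    (fun p : ℝ × Model n ↦ coeff x₀ i j (toSym (α p.1)) p.2) C.toNNReal
    (fun s _ ↦ (continuousOn_coeff x₀ i j (toSym (α s))).mono hK') fun y hy ↦ ?_
  refine (convex_Icc a b).lipschitzOnWith_of_nnnorm_hasDerivWithin_le
    (fun s hs ↦ h.hasDerivWithinAt hs x₀ i j (hK' hy)) fun s hs ↦ ?_
  rw [← NNReal.coe_le_coe, coe_nnnorm]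
  exact (hC (s, y) ⟨hs, hy⟩).trans (Real.le_coe_toNNReal C)

theorem IsC1On.continuousOn_gram (h : IsC1On α v a b) (x₀ : M)
    {K : Set (Model n)} (hK : IsCompact K) (hK' : K ⊆ (chartAt (Model n) x₀).target) :
    ContinuousOn (fun p : ℝ × Model n ↦ gram x₀ (toSym (α p.1)) p.2) (Icc a b ×ˢ K) :=
  continuousOn_pi.mpr fun i ↦ continuousOn_pi.mpr fun j ↦
    h.continuousOn_coeff_uncurry x₀ i j hK hK'

theorem IsC1On.continuousOn_energy (h : IsC1On α v a b) (x₀ : M)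
    {K : Set (Model n)} (hK : IsCompact K) (hK' : K ⊆ (chartAt (Model n) x₀).target) :
    ContinuousOn (fun p : ℝ × Model n ↦
      energy (gram x₀ (toSym (α p.1)) p.2) (gram x₀ (v p.1) p.2)) (Icc a b ×ˢ K) := by
  have hv : ContinuousOn (fun p : ℝ × Model n ↦ gram x₀ (v p.1) p.2) (Icc a b ×ˢ K) :=
    continuousOn_pi.mpr fun i ↦ continuousOn_pi.mpr fun j ↦
      ManifoldOfMetrics.continuousOn_coeff_uncurry h.1 x₀ i j hK hK'
  exact (h.continuousOn_gram x₀ hK hK').energy hv fun p hp ↦ gram_posDef (hK' hp.2) (α p.1)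

theorem IsC1On.congr (h : IsC1On α v a b) {β : ℝ → Metrics n M} {w : ℝ → SymTensorField n M}
    (hα : ∀ t ∈ Icc a b, β t = α t) (hv : ∀ t ∈ Icc a b, w t = v t) : IsC1On β w a b := by
  refine ⟨h.1.congr hv, fun s hs ↦ ?_⟩
  rw [hv s hs]
  refine (h.2 s hs).congr' ?_
  filter_upwards [self_mem_nhdsWithin] with t ht
  simp only [slope, hα s hs, hα t ht.1]

/-- Reparametrisation of a `C¹` path by an isometry `t ↦ εt + c` of `ℝ`, `ε = ±1`. -/
theorem IsC1On.comp_isometry (h : IsC1On α v a b) {ε : ℝ} (hε : ε = 1 ∨ ε = -1) (c : ℝ)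
    {a' b' : ℝ} (hab : ∀ t ∈ Icc a' b', ε * t + c ∈ Icc a b) :
    IsC1On (fun t ↦ α (ε * t + c)) (fun t ↦ ε • v (ε * t + c)) a' b' := by
  have hε2 : ε * ε = 1 := by rcases hε with rfl | rfl <;> norm_num
  have hsmul : Continuous fun h : SymTensorField n M ↦ ε • h := by
    rcases hε with rfl | rfl
    · simpa using! continuous_id
    · simpa using continuous_neg
  have hφ : Continuous fun t : ℝ ↦ ε * t + c := by fun_prop
  refine ⟨hsmul.comp_continuousOn (h.1.comp hφ.continuousOn hab), fun s hs ↦ ?_⟩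
  have hT : Tendsto (fun t ↦ ε * t + c) (𝓝[Icc a' b' \ {s}] s)
      (𝓝[Icc a b \ {ε * s + c}] (ε * s + c)) := by
    refine hφ.continuousWithinAt.tendsto_nhdsWithin fun t ht ↦ ⟨hab t ht.1, fun he ↦ ht.2 ?_⟩
    have he' : ε * t = ε * s := by simpa using he
    calc t = ε * (ε * t) := by rw [← mul_assoc, hε2, one_mul]
      _ = s := by rw [he', ← mul_assoc, hε2, one_mul]
  refine ((hsmul.tendsto _).comp ((h.2 _ (hab s hs)).comp hT)).congr fun t ↦ ?_
  simp only [Function.comp, slope, vsub_eq_sub]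
  rw [smul_smul]
  congr 1
  have : ε * t + c - (ε * s + c) = ε * (t - s) := by ring
  rw [this, mul_inv, ← mul_assoc, mul_inv_cancel₀, one_mul]
  rintro rfl
  norm_num at hε2

variable [CompactSpace M] [T2Space M] [MeasurableSpace M] [BorelSpace M]

/-- The speed of a `C¹` path is continuous. -/
theorem IsC1On.continuousOn_l2Norm (h : IsC1On α v a b) :
    ContinuousOn (fun t ↦ l2Norm (α t) (v t)) (Icc a b) := by
  simp only [l2Norm, l2Inner_self_eq_sum]
  refine ContinuousOn.sqrt (continuousOn_finsetSum _ fun x₀ _ ↦ ?_)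
  refine continuousOn_setIntegral_of_isCompact isCompact_Icc (isCompact_chartSupport x₀) ?_
  refine ContinuousOn.mul ?_
    (h.continuousOn_energy x₀ (isCompact_chartSupport x₀) (chartSupport_subset x₀))
  exact (continuousOn_chartPartition_symm x₀).comp continuousOn_snd
    fun p hp ↦ chartSupport_subset x₀ hp.2

/-- The functional `g ↦ ∫_K F(g_{ij})` for a separating function `F`. -/
def chartFunctional (x₀ : M) (K : Set (Model n)) (c : ℝ) (w : Fin n → ℝ) (g : Metrics n M) : ℝ :=
  ∫ y in K, separator c w (gram x₀ (toSym g) y)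

/-- The functionals `chartFunctional` are Lipschitz along `C¹` paths. -/
theorem IsC1On.chartFunctional_sub_le (h : IsC1On α v a b) (hab : a ≤ b) {x₀ : M}
    {K : Set (Model n)} (hK : IsCompact K) (hK' : K ⊆ (chartAt (Model n) x₀).target) {ε : ℝ}
    (hε : 0 < ε) (hρ : ∀ y ∈ K, ε ≤ chartPartition n M x₀ ((chartAt (Model n) x₀).symm y))
    {c : ℝ} (hc0 : 0 ≤ c) (hc1 : c ≤ 1) (w : Fin n → ℝ) :
    chartFunctional x₀ K c w (α b) - chartFunctional x₀ K c w (α a) ≤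
      (√n + 1) * √(volume.real K) * √ε⁻¹ * ∫ t in a..b, l2Norm (α t) (v t) := by
  set f : ℝ → Model n → ℝ := fun t y ↦
    (√n + 1) * √(energy (gram x₀ (toSym (α t)) y) (gram x₀ (v t) y))
  have hf : ContinuousOn (fun p : ℝ × Model n ↦ f p.1 p.2) (Icc a b ×ˢ K) :=
    continuousOn_const.mul (h.continuousOn_energy x₀ hK hK').sqrt
  have hft (y : Model n) (hy : y ∈ K) : ContinuousOn (fun t ↦ f t y) (Icc a b) :=
    ContinuousOn.uncurry_right y hy hf
  have hfy (t : ℝ) (ht : t ∈ Icc a b) : ContinuousOn (f t) K :=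
    ContinuousOn.uncurry_left t ht hf
  have hpt (y : Model n) (hy : y ∈ K) :
      separator c w (gram x₀ (toSym (α b)) y) - separator c w (gram x₀ (toSym (α a)) y) ≤
        ∫ t in Icc a b, f t y := by
    have hd (s : ℝ) (hs : s ∈ Ioo a b) :=
      exists_hasDerivAt_separator (A := fun t ↦ gram x₀ (toSym (α t)) y) hc0 hc1 w
        (gram_posDef (hK' hy) (α s)) (gram_isSymm x₀ (v s) y) fun i j ↦ (h.hasDerivWithinAt (Ioo_subset_Icc_self hs) x₀ i j (hK' hy)).hasDerivAt
          (Icc_mem_nhds hs.1 hs.2)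
    choose! d hd1 hd2 using hd
    have hcont : ContinuousOn (fun t ↦ separator c w (gram x₀ (toSym (α t)) y)) (Icc a b) :=
      ContinuousOn.separator (ContinuousOn.uncurry_right
        (f := fun t y ↦ gram x₀ (toSym (α t)) y) y hy (h.continuousOn_gram x₀ hK hK'))
        (fun t _ ↦ gram_posDef (hK' hy) (α t)) c w
    have := intervalIntegral.sub_le_integral_of_hasDeriv_right_of_le hab hcont
      (fun s hs ↦ (hd1 s hs).hasDerivWithinAt) ((hft y hy).integrableOn_compact isCompact_Icc)
      fun s hs ↦ by simpa [f] using hd2 s hs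
    rwa [intervalIntegral.integral_of_le hab, ← integral_Icc_eq_integral_Ioc] at this
  have hprod : Integrable (fun p : ℝ × Model n ↦ f p.1 p.2)
      ((volume.restrict (Icc a b)).prod (volume.restrict K)) := by
    rw [Measure.prod_restrict]
    exact hf.integrableOn_compact (isCompact_Icc.prod hK)
  have hspeed := h.continuousOn_l2Norm
  calc chartFunctional x₀ K c w (α b) - chartFunctional x₀ K c w (α a)
      = ∫ y in K, (separator c w (gram x₀ (toSym (α b)) y) -
          separator c w (gram x₀ (toSym (α a)) y)) :=
        (integral_sub (integrableOn_separator x₀ hK hK' c w _)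
          (integrableOn_separator x₀ hK hK' c w _)).symm
    _ ≤ ∫ y in K, ∫ t in Icc a b, f t y :=
        setIntegral_mono_on ((integrableOn_separator x₀ hK hK' c w _).sub
          (integrableOn_separator x₀ hK hK' c w _)) hprod.swap.integral_prod_left
          hK.measurableSet hpt
    _ = ∫ t in Icc a b, ∫ y in K, f t y := (integral_integral_swap hprod).symm
    _ ≤ ∫ t in Icc a b, (√n + 1) * √(volume.real K) * √ε⁻¹ * l2Norm (α t) (v t) := by
        refine setIntegral_mono_on hprod.integral_prod_left
          ((hspeed.const_mul _).integrableOn_compact isCompact_Icc)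
          measurableSet_Icc fun t ht ↦ ?_
        have hE := (continuousOn_energy_gram x₀ (α t) (v t)).mono hK'
        have hle := mul_setIntegral_energy_le hK hK' hε hρ (α t) (v t)
        calc ∫ y in K, f t y
            = (√n + 1) * ∫ y in K, √(energy (gram x₀ (toSym (α t)) y) (gram x₀ (v t) y)) :=
              integral_const_mul _ _
          _ ≤ (√n + 1) * (√(volume.real K) *
                √(∫ y in K, energy (gram x₀ (toSym (α t)) y) (gram x₀ (v t) y))) := by
              gcongr
              exact setIntegral_sqrt_le hK.measurableSet hK.measure_ne_top
                (hE.integrableOn_compact hK) (hE.sqrt.integrableOn_compact hK) fun y hy ↦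
                  energy_nonneg (gram_posDef (hK' hy) (α t)) (gram_isSymm _ _ _)
          _ ≤ (√n + 1) * (√(volume.real K) * √(ε⁻¹ * l2Inner (α t) (v t) (v t))) := by
              gcongr
              rwa [le_inv_mul_iff₀ hε]
          _ = _ := by
              rw [Real.sqrt_mul (by positivity), l2Norm]; ring
    _ = _ := by
        rw [integral_const_mul, intervalIntegral.integral_of_le hab, integral_Icc_eq_integral_Ioc]

end Path

/-! ### Operations on paths -/

section Operations

variable {n : ℕ} {M : Type*} [TopologicalSpace M] [ChartedSpace (Model n) M]
  [IsManifold (𝓡 n) ∞ M]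

/-- The constant path, on a degenerate interval. -/
def MetricPath.refl (g : Metrics n M) : MetricPath g g where
  a := 0
  b := 0
  le := le_rfl
  toFun _ := g
  velocity _ := 0
  source := rfl
  target := rfl
  piecewise := ⟨0, fun _ ↦ 0, monotone_const, rfl, rfl, by simp⟩

/-- The path run backwards. -/
def MetricPath.symm {g₀ g₁ : Metrics n M} (p : MetricPath g₀ g₁) : MetricPath g₁ g₀ where
  a := -p.b
  b := -p.a
  le := neg_le_neg p.le
  toFun t := p.toFun (-t)
  velocity t := -p.velocity (-t)
  source := by simp [p.target]
  target := by simp [p.source]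
  piecewise := by
    obtain ⟨N, t, ht, h0, hN, h⟩ := p.piecewise
    refine ⟨N, fun k ↦ -t (N - k), fun k l hkl ↦ neg_le_neg (ht (by omega)), by simp [hN],
      by simp [h0], fun i hi ↦ ?_⟩
    obtain ⟨v, hv, hv'⟩ := h (N - (i + 1)) (by omega)
    have hi' : N - (i + 1) + 1 = N - i := by omega
    rw [hi'] at hv hv'
    refine ⟨fun s ↦ -v (-s), ?_, fun s hs ↦ ?_⟩
    · have := hv.comp_isometry (Or.inr rfl) 0 (a' := -t (N - i)) (b' := -t (N - (i + 1)))
        fun s hs ↦ by constructor <;> linarith [hs.1, hs.2]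
      simpa using! this
    · simp only
      rw [hv' (-s) (by constructor <;> linarith [hs.1, hs.2])]

/-- The path with time translated by `c`. -/
def MetricPath.shift {g₀ g₁ : Metrics n M} (p : MetricPath g₀ g₁) (c : ℝ) : MetricPath g₀ g₁ where
  a := p.a - c
  b := p.b - c
  le := sub_le_sub_right p.le c
  toFun t := p.toFun (t + c)
  velocity t := p.velocity (t + c)
  source := by simp [p.source]
  target := by simp [p.target]
  piecewise := by
    obtain ⟨N, t, ht, h0, hN, h⟩ := p.piecewise
    refine ⟨N, fun k ↦ t k - c, fun k l hkl ↦ sub_le_sub_right (ht hkl) c, by simp [h0],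
      by simp [hN], fun i hi ↦ ?_⟩
    obtain ⟨v, hv, hv'⟩ := h i hi
    refine ⟨fun s ↦ v (s + c), ?_, fun s hs ↦ ?_⟩
    · have := hv.comp_isometry (Or.inl rfl) c (a' := t i - c) (b' := t (i + 1) - c)
        fun s hs ↦ by constructor <;> linarith [hs.1, hs.2]
      simpa using! this
    · exact hv' (s + c) (by constructor <;> linarith [hs.1, hs.2])

/-- The concatenation of two paths, the second of which starts when the first one ends. -/
def MetricPath.trans {g₀ g₁ g₂ : Metrics n M} (p : MetricPath g₀ g₁) (q : MetricPath g₁ g₂)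
    (hpq : p.b = q.a) : MetricPath g₀ g₂ where
  a := p.a
  b := q.b
  le := p.le.trans (hpq.le.trans q.le)
  toFun t := if t ≤ p.b then p.toFun t else q.toFun t
  velocity t := if t ≤ p.b then p.velocity t else q.velocity t
  source := by simp [p.le, p.source]
  target := by
    split_ifs with h
    · have : q.a = q.b := le_antisymm q.le (hpq ▸ h)
      rw [← this, ← hpq, p.target, ← q.source, this, q.target]
    · exact q.target
  piecewise := by
    obtain ⟨N, t, ht, ht0, htN, h⟩ := p.piecewise
    obtain ⟨N', t', ht', ht0', htN', h'⟩ := q.piecewise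
    -- the two formulas for the subdivision agree at the index `N`
    set r : ℕ → ℝ := fun k ↦ if k ≤ N then t k else t' (k - N)
    have hr1 (k : ℕ) (hk : k ≤ N) : r k = t k := if_pos hk
    have hr2 (m : ℕ) : r (N + m) = t' m := by
      rcases Nat.eq_zero_or_pos m with rfl | hm
      · rw [add_zero, hr1 N le_rfl, htN, ht0', hpq]
      · simp only [r]
        rw [if_neg (by omega), Nat.add_sub_cancel_left]
    refine ⟨N + N', r, monotone_nat_of_le_succ fun k ↦ ?_, by rw [hr1 0 (Nat.zero_le _), ht0],
      by rw [hr2, htN'], fun i hi ↦ ?_⟩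
    · rcases lt_or_ge k N with hk | hk
      · rw [hr1 k hk.le, hr1 (k + 1) hk]
        exact ht (Nat.le_succ k)
      · obtain ⟨m, rfl⟩ := Nat.exists_eq_add_of_le hk
        rw [add_assoc, hr2, hr2]
        exact ht' (Nat.le_succ m)
    · rcases lt_or_ge i N with hk | hk
      · rw [hr1 i hk.le, hr1 (i + 1) hk]
        obtain ⟨v, hv, hv'⟩ := h i hk
        have hle : t (i + 1) ≤ p.b := htN ▸ ht (show i + 1 ≤ N from hk)
        refine ⟨v, hv.congr (fun s hs ↦ if_pos (hs.2.trans hle)) fun _ _ ↦ rfl, fun s hs ↦ ?_⟩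
        rw [if_pos (hs.2.le.trans hle), hv' s hs]
      · obtain ⟨m, rfl⟩ := Nat.exists_eq_add_of_le hk
        rw [add_assoc, hr2, hr2]
        obtain ⟨v, hv, hv'⟩ := h' m (by omega)
        have hle : p.b ≤ t' m := by rw [hpq, ← ht0']; exact ht' (Nat.zero_le m)
        refine ⟨v, hv.congr (fun s hs ↦ ?_) fun _ _ ↦ rfl, fun s hs ↦ ?_⟩
        · split_ifs with hsb
          · have : s = p.b := le_antisymm hsb (hle.trans hs.1)
            rw [this, p.target, hpq, q.source]
          · rfl
        · rw [if_neg (not_le.mpr (hle.trans_lt hs.1)), hv' s hs]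

theorem isVonNBounded_of_le {E : Type*} [AddCommGroup E] [Module ℝ E] [TopologicalSpace E]
    [IsTopologicalAddGroup E] [ContinuousSMul ℝ E] {B B' : E →L[ℝ] E →L[ℝ] ℝ}
    (hB : Bornology.IsVonNBounded ℝ {v : E | B v v < 1}) (h : ∀ v, B v v ≤ 2 * B' v v) :
    Bornology.IsVonNBounded ℝ {v : E | B' v v < 1} := by
  refine (hB.image ((2 : ℝ) • ContinuousLinearMap.id ℝ E)).subset fun v hv ↦ ?_
  refine ⟨(2⁻¹ : ℝ) • v, ?_, by simp⟩
  have := h v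
  have hv' : B' v v < 1 := hv
  simp only [mem_ofPred_eq, map_smul, smul_apply, smul_eq_mul]
  linarith

theorem Metrics.inner_nonneg (g : Metrics n M) (x : M) (v : TangentSpace (𝓡 n) x) :
    0 ≤ g.inner x v v := by
  rcases eq_or_ne v 0 with rfl | hv
  · simp
  · exact (g.pos x v hv).le

/-- The convex combination `(1 - s) g₀ + s g₁`. -/
def convexComb (g₀ g₁ : Metrics n M) (s : ℝ) (hs : s ∈ Icc (0 : ℝ) 1) : Metrics n M where
  inner := ((1 - s) • toSym g₀ + s • toSym g₁).1
  symm := ((1 - s) • toSym g₀ + s • toSym g₁).2.1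
  contMDiff := ((1 - s) • toSym g₀ + s • toSym g₁).2.2
  pos x v hv := by
    change 0 < (1 - s) * g₀.inner x v v + s * g₁.inner x v v
    have h0 := g₀.pos x v hv
    have h1 := g₁.pos x v hv
    rcases hs.1.eq_or_lt with rfl | hs0
    · simpa using h0
    · have := mul_pos hs0 h1
      have := mul_nonneg (sub_nonneg.mpr hs.2) h0.le
      linarith
  isVonNBounded x := by
    have key (v : TangentSpace (𝓡 n) x) : ((1 - s) • toSym g₀ + s • toSym g₁).1 x v v =
        (1 - s) * g₀.inner x v v + s * g₁.inner x v v := rfl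
    rcases le_total s (1 / 2) with h | h
    · refine isVonNBounded_of_le (g₀.isVonNBounded x) fun v ↦ ?_
      rw [key]
      nlinarith [g₀.inner_nonneg x v, mul_nonneg hs.1 (g₁.inner_nonneg x v)]
    · refine isVonNBounded_of_le (g₁.isVonNBounded x) fun v ↦ ?_
      rw [key]
      nlinarith [g₁.inner_nonneg x v, mul_nonneg (sub_nonneg.mpr hs.2) (g₀.inner_nonneg x v)]

theorem toSym_convexComb (g₀ g₁ : Metrics n M) (s : ℝ) (hs : s ∈ Icc (0 : ℝ) 1) :
    toSym (convexComb g₀ g₁ s hs) = (1 - s) • toSym g₀ + s • toSym g₁ := rfl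

theorem toSym_injective : Function.Injective (toSym : Metrics n M → SymTensorField n M) := by
  intro g₀ g₁ h
  have h' : g₀.inner = g₁.inner := congrArg Subtype.val h
  cases g₀; cases g₁; cases h'; rfl

theorem inv_smul_segment_sub {V : Type*} [AddCommGroup V] [Module ℝ V] (x y : V) {s t : ℝ}
    (h : t - s ≠ 0) : (t - s)⁻¹ • ((1 - t) • x + t • y - ((1 - s) • x + s • y)) = y - x := by
  rw [inv_smul_eq_iff₀ h]
  module

/-- The segment from `g₀` to `g₁`, continued by constants outside `[0, 1]`. -/
def segmentFun (g₀ g₁ : Metrics n M) (t : ℝ) : Metrics n M :=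
  convexComb g₀ g₁ (projIcc 0 1 zero_le_one t) (projIcc 0 1 zero_le_one t).2

theorem toSym_segmentFun (g₀ g₁ : Metrics n M) {t : ℝ} (ht : t ∈ Icc (0 : ℝ) 1) :
    toSym (segmentFun g₀ g₁ t) = (1 - t) • toSym g₀ + t • toSym g₁ := by
  rw [segmentFun, toSym_convexComb, projIcc_of_mem zero_le_one ht]

theorem isC1On_segmentFun (g₀ g₁ : Metrics n M) :
    IsC1On (segmentFun g₀ g₁) (fun _ ↦ toSym g₁ - toSym g₀) 0 1 := by
  refine ⟨continuousOn_const, fun s hs ↦ tendsto_const_nhds.congr' ?_⟩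
  filter_upwards [self_mem_nhdsWithin] with t ht
  rw [slope, toSym_segmentFun g₀ g₁ ht.1, toSym_segmentFun g₀ g₁ hs, vsub_eq_sub]
  exact (inv_smul_segment_sub _ _ (sub_ne_zero.mpr ht.2)).symm

/-- The segment from `g₀` to `g₁` as a path. -/
def MetricPath.segment (g₀ g₁ : Metrics n M) : MetricPath g₀ g₁ where
  a := 0
  b := 1
  le := zero_le_one
  toFun := segmentFun g₀ g₁
  velocity _ := toSym g₁ - toSym g₀
  source := toSym_injective (by simp [toSym_segmentFun])
  target := toSym_injective (by simp [toSym_segmentFun])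
  piecewise := by
    refine ⟨1, fun k ↦ if k = 0 then 0 else 1, monotone_nat_of_le_succ fun k ↦ ?_, by simp,
      by simp, fun i hi ↦ ?_⟩
    · split_ifs <;> simp_all
    · obtain rfl : i = 0 := by omega
      refine ⟨fun _ ↦ toSym g₁ - toSym g₀, ?_, fun _ _ ↦ rfl⟩
      simpa using! isC1On_segmentFun g₀ g₁

end Operations

/-! ### Length and distance -/

section Distance

variable {n : ℕ} {M : Type*} [TopologicalSpace M] [ChartedSpace (Model n) M]
  [IsManifold (𝓡 n) ∞ M] [CompactSpace M] [T2Space M] [MeasurableSpace M]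
  {g₀ g₁ g₂ : Metrics n M}

theorem MetricPath.length_nonneg (p : MetricPath g₀ g₁) : 0 ≤ p.length :=
  intervalIntegral.integral_nonneg p.le fun _ _ ↦ Real.sqrt_nonneg _

theorem MetricPath.length_shift (p : MetricPath g₀ g₁) (c : ℝ) :
    (p.shift c).length = p.length := by
  simp only [MetricPath.length, MetricPath.shift]
  rw [intervalIntegral.integral_comp_add_right (fun t ↦ l2Norm (p.toFun t) (p.velocity t)),
    sub_add_cancel, sub_add_cancel]

theorem bddBelow_length : BddBelow (range fun p : MetricPath g₀ g₁ ↦ p.length) :=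
  ⟨0, by rintro _ ⟨p, rfl⟩; exact p.length_nonneg⟩

theorem l2Dist_le_length (p : MetricPath g₀ g₁) : l2Dist g₀ g₁ ≤ p.length :=
  ciInf_le bddBelow_length p

instance instNonemptyMetricPath : Nonempty (MetricPath g₀ g₁) := ⟨.segment g₀ g₁⟩

theorem l2Dist_nonneg (g₀ g₁ : Metrics n M) : 0 ≤ l2Dist g₀ g₁ :=
  le_ciInf fun p ↦ p.length_nonneg

theorem l2Dist_self (g : Metrics n M) : l2Dist g g = 0 := by
  refine le_antisymm ((l2Dist_le_length (.refl g)).trans_eq ?_) (l2Dist_nonneg g g)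
  simp [MetricPath.length, MetricPath.refl]

variable [BorelSpace M]

theorem IsC1On.intervalIntegrable {α : ℝ → Metrics n M} {v w : ℝ → SymTensorField n M} {a b : ℝ}
    (h : IsC1On α v a b) (hab : a ≤ b) (hw : ∀ s ∈ Ioo a b, w s = v s) :
    IntervalIntegrable (fun t ↦ l2Norm (α t) (w t)) volume a b := by
  refine IntervalIntegrable.congr_uIoo (h.continuousOn_l2Norm.intervalIntegrable_of_Icc hab) ?_
  rw [uIoo_of_le hab]
  intro s hs
  simp only [hw s hs]

/-- The speed of a path is integrable, so that the integral defining its length has no junk value: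
without this, neither additivity nor positive lower bounds would hold. -/
theorem MetricPath.intervalIntegrable (p : MetricPath g₀ g₁) :
    IntervalIntegrable (fun t ↦ l2Norm (p.toFun t) (p.velocity t)) volume p.a p.b := by
  obtain ⟨N, t, ht, h0, hN, h⟩ := p.piecewise
  rw [← h0, ← hN]
  refine IntervalIntegrable.trans_iterate fun i hi ↦ ?_
  obtain ⟨v, hv, hv'⟩ := h i hi
  exact hv.intervalIntegrable (ht (Nat.le_succ i)) hv'

theorem MetricPath.length_symm (p : MetricPath g₀ g₁) : p.symm.length = p.length := by
  simp only [MetricPath.length, MetricPath.symm, l2Norm_neg]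
  rw [intervalIntegral.integral_comp_neg (fun t ↦ l2Norm (p.toFun t) (p.velocity t)), neg_neg,
    neg_neg]

theorem MetricPath.length_trans (p : MetricPath g₀ g₁) (q : MetricPath g₁ g₂) (hpq : p.b = q.a) :
    (p.trans q hpq).length = p.length + q.length := by
  have hle : p.b ≤ q.b := hpq.le.trans q.le
  set f : ℝ → ℝ := fun t ↦ l2Norm ((p.trans q hpq).toFun t) ((p.trans q hpq).velocity t)
  have hi : IntervalIntegrable f volume p.a q.b := (p.trans q hpq).intervalIntegrable
  have hb : p.b ∈ uIcc p.a q.b := by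
    rw [uIcc_of_le (p.le.trans hle)]
    exact ⟨p.le, hle⟩
  have h1 : ∫ t in p.a..p.b, f t = p.length := by
    refine intervalIntegral.integral_congr_Ioo_of_le p.le fun t ht ↦ ?_
    simp only [f, MetricPath.trans, if_pos ht.2.le]
  have h2 : ∫ t in p.b..q.b, f t = q.length := by
    rw [MetricPath.length, ← hpq]
    refine intervalIntegral.integral_congr_Ioo_of_le hle fun t ht ↦ ?_
    simp only [f, MetricPath.trans, if_neg (not_le.mpr ht.1)]
  rw [← h1, ← h2, intervalIntegral.integral_add_adjacent_intervals
    (hi.mono_set (uIcc_subset_uIcc_left hb)) (hi.mono_set (uIcc_subset_uIcc_right hb))]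
  rfl

/-- The functionals `chartFunctional` are Lipschitz for the length of paths. -/
theorem MetricPath.chartFunctional_sub_le (p : MetricPath g₀ g₁) {x₀ : M}
    {K : Set (Model n)} (hK : IsCompact K) (hK' : K ⊆ (chartAt (Model n) x₀).target) {ε : ℝ}
    (hε : 0 < ε) (hρ : ∀ y ∈ K, ε ≤ chartPartition n M x₀ ((chartAt (Model n) x₀).symm y))
    {c : ℝ} (hc0 : 0 ≤ c) (hc1 : c ≤ 1) (w : Fin n → ℝ) :
    chartFunctional x₀ K c w g₁ - chartFunctional x₀ K c w g₀ ≤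
      (√n + 1) * √(volume.real K) * √ε⁻¹ * p.length := by
  obtain ⟨N, t, ht, h0, hN, h⟩ := p.piecewise
  have hint (i : ℕ) (hi : i < N) : IntervalIntegrable
      (fun t ↦ l2Norm (p.toFun t) (p.velocity t)) volume (t i) (t (i + 1)) := by
    obtain ⟨v, hv, hv'⟩ := h i hi
    exact hv.intervalIntegrable (ht (Nat.le_succ i)) hv'
  suffices H : chartFunctional x₀ K c w (p.toFun p.b) - chartFunctional x₀ K c w (p.toFun p.a) ≤
      (√n + 1) * √(volume.real K) * √ε⁻¹ * p.length by
    rwa [p.source, p.target] at H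
  rw [MetricPath.length, ← h0, ← hN, ← intervalIntegral.sum_integral_adjacent_intervals hint, Finset.mul_sum,
    ← Finset.sum_range_sub (fun i ↦ chartFunctional x₀ K c w (p.toFun (t i)))]
  refine Finset.sum_le_sum fun i hi ↦ ?_
  have hle := ht (Nat.le_succ i)
  obtain ⟨v, hv, hv'⟩ := h i (Finset.mem_range.mp hi)
  refine (hv.chartFunctional_sub_le hle hK hK' hε hρ hc0 hc1 w).trans_eq ?_
  congr 1
  refine intervalIntegral.integral_congr_Ioo_of_le hle fun s hs ↦ ?_
  simp only [hv' s hs]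

theorem l2Dist_comm (g₀ g₁ : Metrics n M) : l2Dist g₀ g₁ = l2Dist g₁ g₀ := by
  have key (g₀ g₁ : Metrics n M) : l2Dist g₀ g₁ ≤ l2Dist g₁ g₀ :=
    le_ciInf fun p ↦ (l2Dist_le_length p.symm).trans_eq p.length_symm
  exact le_antisymm (key _ _) (key _ _)

theorem l2Dist_triangle (g₀ g₁ g₂ : Metrics n M) :
    l2Dist g₀ g₂ ≤ l2Dist g₀ g₁ + l2Dist g₁ g₂ := by
  refine le_ciInf_add_ciInf fun p q ↦ ?_
  have h : p.b = (q.shift (q.a - p.b)).a := by simp [MetricPath.shift]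
  refine (l2Dist_le_length (p.trans (q.shift (q.a - p.b)) h)).trans_eq ?_
  rw [MetricPath.length_trans, MetricPath.length_shift]

/-- If a separating function is larger for `g₁` than for `g₀` at some point, then it is so on a
neighbourhood, and a Lipschitz functional distinguishes `g₀` from `g₁`. -/
theorem l2Dist_pos_of_separator_lt {x₀ : M} {y : Model n}
    (hy : y ∈ (chartAt (Model n) x₀).target)
    (hρ : 0 < chartPartition n M x₀ ((chartAt (Model n) x₀).symm y))
    {c : ℝ} (hc0 : 0 ≤ c) (hc1 : c ≤ 1) {w : Fin n → ℝ}
    (hlt : separator c w (gram x₀ (toSym g₀) y) < separator c w (gram x₀ (toSym g₁) y)) :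
    0 < l2Dist g₀ g₁ := by
  have hnhds := (chartAt (Model n) x₀).open_target.mem_nhds hy
  have hF (g : Metrics n M) : ContinuousOn (fun y ↦ separator c w (gram x₀ (toSym g) y))
      (chartAt (Model n) x₀).target :=
    (continuousOn_gram x₀ (toSym g)).separator (fun _ hy ↦ gram_posDef hy g) c w
  set ε := chartPartition n M x₀ ((chartAt (Model n) x₀).symm y) / 2
  set D : Model n → ℝ := fun y ↦
    separator c w (gram x₀ (toSym g₁) y) - separator c w (gram x₀ (toSym g₀) y)
  have hε : 0 < ε := half_pos hρ
  have hD : 0 < D y := sub_pos.mpr hlt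
  have h1 : ∀ᶠ z in 𝓝 y, ε ≤ chartPartition n M x₀ ((chartAt (Model n) x₀).symm z) :=
    ((continuousOn_chartPartition_symm x₀).continuousAt hnhds).eventually
      (eventually_ge_nhds (half_lt_self hρ))
  have h2 : ∀ᶠ z in 𝓝 y, D y / 2 ≤ D z :=
    (((hF g₁).sub (hF g₀)).continuousAt hnhds).eventually (eventually_ge_nhds (half_lt_self hD))
  obtain ⟨r, hr, hK⟩ := Metric.nhds_basis_closedBall.mem_iff.mp
    (inter_mem (inter_mem hnhds h1) h2)
  set K := Metric.closedBall y r
  have hKc : IsCompact K := isCompact_closedBall y r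
  have hK' : K ⊆ (chartAt (Model n) x₀).target := fun z hz ↦ (hK hz).1.1
  have hvol : 0 < volume.real K := by
    rw [measureReal_def]
    exact ENNReal.toReal_pos (Metric.measure_closedBall_pos _ y hr).ne' hKc.measure_ne_top
  have hC : 0 < (√n + 1) * √(volume.real K) * √ε⁻¹ := by positivity
  have hlow : D y / 2 * volume.real K ≤
      chartFunctional x₀ K c w g₁ - chartFunctional x₀ K c w g₀ := by
    rw [chartFunctional, chartFunctional, ← integral_sub (integrableOn_separator x₀ hKc hK' c w g₁)
      (integrableOn_separator x₀ hKc hK' c w g₀)]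
    calc D y / 2 * volume.real K = ∫ _ in K, D y / 2 := by simp [mul_comm]
      _ ≤ _ := setIntegral_mono_on (integrableOn_const hKc.measure_ne_top)
        ((integrableOn_separator x₀ hKc hK' c w g₁).sub
          (integrableOn_separator x₀ hKc hK' c w g₀)) hKc.measurableSet fun z hz ↦ (hK hz).2
  have hpos : 0 < D y / 2 * volume.real K := by positivity
  refine (div_pos hpos hC).trans_le (le_ciInf fun p ↦ ?_)
  rw [div_le_iff₀' hC]
  exact hlow.trans (p.chartFunctional_sub_le hKc hK' hε (fun z hz ↦ (hK hz).1.2) hc0 hc1 w)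

theorem l2Dist_pos (hne : g₀ ≠ g₁) : 0 < l2Dist g₀ g₁ := by
  obtain ⟨x, hx⟩ := exists_gram_ne hne
  obtain ⟨x₀, hx₀⟩ := (chartPartition n M).exists_pos_of_mem (mem_univ x)
  have hxs : x ∈ (chartAt (Model n) x₀).source :=
    tsupport_chartPartition_subset x₀ (subset_tsupport _ hx₀.ne')
  have hy := (chartAt (Model n) x₀).map_source hxs
  have hρ : 0 < chartPartition n M x₀
      ((chartAt (Model n) x₀).symm (chartAt (Model n) x₀ x)) := by
    rwa [(chartAt (Model n) x₀).left_inv hxs]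
  obtain ⟨c, w, hc0, hc1, hcw⟩ :=
    exists_separator_ne (gram_posDef hy g₀) (gram_posDef hy g₁) (hx x₀ hxs)
  rcases hcw.lt_or_gt with h | h
  · exact l2Dist_pos_of_separator_lt hy hρ hc0 hc1 h
  · rw [l2Dist_comm]
    exact l2Dist_pos_of_separator_lt hy hρ hc0 hc1 h

end Distance

end ManifoldOfMetrics

end
/-- `(𝓜, d)` is a metric space. -/
theorem mainTheorem2 (n : ℕ) (M : Type*) [TopologicalSpace M]
    [ChartedSpace (EuclideanSpace ℝ (Fin n)) M] [IsManifold (𝓡 n) ∞ M]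
    [CompactSpace M] [T2Space M] [MeasurableSpace M] [BorelSpace M] :
    ∃ m : MetricSpace (ManifoldOfMetrics.Metrics n M),
      ∀ g₀ g₁ : ManifoldOfMetrics.Metrics n M, m.dist g₀ g₁ = ManifoldOfMetrics.l2Dist g₀ g₁ := by
  refine ⟨{ dist := ManifoldOfMetrics.l2Dist
            dist_self := ManifoldOfMetrics.l2Dist_self
            dist_comm := ManifoldOfMetrics.l2Dist_comm
            dist_triangle := ManifoldOfMetrics.l2Dist_triangle
            eq_of_dist_eq_zero := fun {g₀ g₁} h ↦ ?_ }, fun _ _ ↦ rfl⟩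
  by_contra hne
  exact (ManifoldOfMetrics.l2Dist_pos hne).ne' h
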